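/- Let $d\ge 1$. For $z=(x,\omega)\in\mathbb R^{2d}$ let $\pi(z)\psi(t)=e^{2\pi i\omega\cdot t}\psi(t-x)$ on $L^2(\mathbb R^d)$, let $P\psi(t)=\psi(-t)$, and for bounded operators $A$ on $L^2(\mathbb R^d)$ put $\alpha_z(A)=\pi(z)A\pi(z)^*$ and $\check A=PAP$. For trace class operators $S,T$ define the function $S\star T(z)=\operatorname{tr}(S\,\alpha_z(\check T))$ on $\mathbb R^{2d}$, and put $\tilde S=S\star\check S$. For $f\in L^1(\mathbb R^{2d})$ let $f\star S=\int_{\mathbb R^{2d}}f(z)\,\alpha_z(S)\,dz$, the integral being taken in the weak sense. For $\psi\in L^2(\mathbb R^d)$ let $Q_S(\psi)=\check S\star(\psi\otimes\psi)$, where $(\psi\otimes\psi)\xi=\langle\xi,\psi\rangle\psi$. Let $M^*_{op}$ be the set of positive trace class operators $S$ on $L^2(\mathbb R^d)$ with $\operatorname{tr}(S)=1$ and $\|S\|_{M^*_{op}}^2:=\int_{\mathbb R^{2d}}\tilde S(z)\,|z|\,dz<\infty$, where $|z|$ is the Euclidean norm. For $\Omega\subset\mathbb R^{2d}$ write $|\Omega|$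 for its Lebesgue measure, $\chi_\Omega$ for its characteristic function, and $$|\partial\Omega|=\operatorname{Var}(\chi_\Omega)=\sup\Big\{\int_\Omega \operatorname{div}F(z)\,dz : F\in C_c^1(\mathbb R^{2d},\mathbb R^{2d}),\ |F(z)|\le 1 \text{ for all } z\Big\};$$ $\Omega$ has finite perimeter if $|\partial\Omega|<\infty$. For $S\in M^*_{op}$ and compact $\Omega\subset\mathbb R^{2d}$, let $$\chi_\Omega\star S=\sum_{k=1}^\infty\lambda_k^\Omega\,h_k^\Omega\otimes h_k^\Omega$$ be any spectral representation of the positive trace class operator $\chi_\Omega\star S$, with eigenvalues $\lambda_1^\Omega\ge\lambda_2^\Omega\ge\cdots$ and an orthonormal sequence $(h_k^\Omega)_{k\ge1}$ of eigenfunctions, and let $$\rho_\Omega^S(z)=\sum_{k=1}^{\lceil|\Omega|\rceil}Q_S(h_k^\Omega)(z),\qquad z\in\mathbb R^{2d}.$$ **Theorem.** Fix $\epsilon>0$. If $S\in M^*_{op}$ and $\Omega\subset\mathbb R^{2d}$ is a compact set with finite perimeter satisfying $|\partial\Omega|\ge\epsilon$, then $\rho_\Omega^S-\chi_\Omega\in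 L^1(\mathbb R^{2d})$ and $$\|\rho_\Omega^S-\chi_\Omega\|_{L^1}\le\Big(\frac1\epsilon+2\|S\|_{M^*_{op}}^2\Big)|\partial\Omega|.$$ -/

import Mathlib

open MeasureTheory Filter Topology
open scoped ENNReal InnerProductSpace

noncomputable section

namespace QHA

/-! ### Spaces -/

/-- Configuration space `ℝᵈ` with its Euclidean norm and Lebesgue measure. -/
abbrev Rn (d : ℕ) : Type := EuclideanSpace ℝ (Fin d)

/-- Phase space `ℝ²ᵈ`, whose points are pairs `z = (x, ω)`, with the Euclidean norm
`|z| = (|x|² + |ω|²)^{1/2}` and Lebesgue measure. -/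
abbrev Phase (d : ℕ) : Type := WithLp 2 (Rn d × Rn d)

/-- The Hilbert space `L²(ℝᵈ)` of complex-valued functions. -/
abbrev L2 (d : ℕ) : Type := Lp ℂ 2 (volume : Measure (Rn d))

/-- Bounded operators on `L²(ℝᵈ)`. -/
abbrev Op (d : ℕ) : Type := L2 d →L[ℂ] L2 d

/-! ### Time-frequency shifts and parity -/

/-- The translation operator `T_x ψ(t) = ψ(t - x)`. -/
def translation {d : ℕ} (x : Rn d) : L2 d →ₗᵢ[ℂ] L2 d :=
  Lp.compMeasurePreservingₗᵢ ℂ (fun t => t - x) (measurePreserving_sub_right volume x)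

/-- The parity operator `P ψ(t) = ψ(-t)`. -/
def parity (d : ℕ) : L2 d →ₗᵢ[ℂ] L2 d :=
  Lp.compMeasurePreservingₗᵢ ℂ (fun t => -t) (Measure.measurePreserving_neg volume)

/-- The character `t ↦ e^{2πi ω·t}`. -/
def character {d : ℕ} (ω t : Rn d) : ℂ :=
  Complex.exp (2 * Real.pi * Complex.I * (inner ℝ ω t : ℝ))

theorem norm_character {d : ℕ} (ω t : Rn d) : ‖character ω t‖ = 1 := by
  have h : 2 * (Real.pi : ℂ) * Complex.I * ((inner ℝ ω t : ℝ) : ℂ)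
      = ((2 * Real.pi * inner ℝ ω t : ℝ) : ℂ) * Complex.I := by
    push_cast; ring
  rw [character, h, Complex.norm_exp_ofReal_mul_I]

theorem continuous_character {d : ℕ} :
    Continuous (fun p : Rn d × Rn d => character p.1 p.2) := by
  unfold character
  fun_prop

theorem continuous_character_right {d : ℕ} (ω : Rn d) : Continuous (character ω) := by
  unfold character
  fun_prop

theorem memLp_modulation {d : ℕ} (ω : Rn d) (ψ : L2 d) :
    MemLp (fun t => character ω t * ψ t) 2 (volume : Measure (Rn d)) := by
  refine (Lp.memLp ψ).of_le ?_ (Eventually.of_forall fun t => ?_)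
  · exact (continuous_character_right ω).aestronglyMeasurable.mul (Lp.aestronglyMeasurable ψ)
  · rw [norm_mul, norm_character, one_mul]

/-- The modulation operator `M_ω ψ(t) = e^{2πi ω·t} ψ(t)`. -/
def modulation {d : ℕ} (ω : Rn d) : L2 d →ₗᵢ[ℂ] L2 d where
  toFun ψ := (memLp_modulation ω ψ).toLp
  map_add' ψ φ := by
    apply Lp.ext
    filter_upwards [(memLp_modulation ω (ψ + φ)).coeFn_toLp, (memLp_modulation ω ψ).coeFn_toLp,
      (memLp_modulation ω φ).coeFn_toLp, Lp.coeFn_add ψ φ,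
      Lp.coeFn_add (memLp_modulation ω ψ).toLp (memLp_modulation ω φ).toLp] with t h1 h2 h3 h4 h5
    rw [h1, h5, Pi.add_apply, h2, h3, h4, Pi.add_apply, mul_add]
  map_smul' c ψ := by
    apply Lp.ext
    filter_upwards [(memLp_modulation ω (c • ψ)).coeFn_toLp, (memLp_modulation ω ψ).coeFn_toLp,
      Lp.coeFn_smul c ψ, Lp.coeFn_smul c (memLp_modulation ω ψ).toLp] with t h1 h2 h3 h4
    rw [h1, RingHom.id_apply, h4, Pi.smul_apply, h2, h3, Pi.smul_apply, smul_eq_mul, smul_eq_mul]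
    ring
  norm_map' ψ := by
    change ‖(memLp_modulation ω ψ).toLp‖ = ‖ψ‖
    rw [Lp.norm_toLp, Lp.norm_def]
    congr 1
    refine eLpNorm_congr_norm_ae (Eventually.of_forall fun t => ?_)
    rw [norm_mul, norm_character, one_mul]

theorem coeFn_modulation {d : ℕ} (ω : Rn d) (ψ : L2 d) :
    modulation ω ψ =ᵐ[volume] fun t => character ω t * ψ t :=
  (memLp_modulation ω ψ).coeFn_toLp

theorem coeFn_translation {d : ℕ} (x : Rn d) (ψ : L2 d) :
    translation x ψ =ᵐ[volume] fun t => ψ (t - x) :=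
  Lp.coeFn_compMeasurePreserving ψ (measurePreserving_sub_right volume x)

/-- The time-frequency shift `π(z) = M_ω T_x` for `z = (x, ω)`. -/
def tfShift {d : ℕ} (z : Phase d) : Op d :=
  (modulation z.snd).toContinuousLinearMap ∘L (translation z.fst).toContinuousLinearMap

/-- The translate `α_z(A) = π(z) A π(z)*` of an operator. -/
def opShift {d : ℕ} (z : Phase d) (A : Op d) : Op d :=
  tfShift z ∘L A ∘L ContinuousLinearMap.adjoint (tfShift z)

/-- The involution `Ǎ = P A P`. -/
def opCheck {d : ℕ} (A : Op d) : Op d :=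
  (parity d).toContinuousLinearMap ∘L A ∘L (parity d).toContinuousLinearMap

/-! ### Trace and trace class -/

section Trace

variable {H : Type*} [NormedAddCommGroup H] [InnerProductSpace ℂ H] [CompleteSpace H]

/-- An orthonormal basis of the Hilbert space `H`. -/
def onb (H : Type*) [NormedAddCommGroup H] [InnerProductSpace ℂ H] [CompleteSpace H] :
    HilbertBasis (exists_hilbertBasis ℂ H).choose ℂ H :=
  (exists_hilbertBasis ℂ H).choose_spec.choose

/-- The trace `tr(A) = ∑ₖ ⟨A eₖ, eₖ⟩`. (Mathlib's `⟪u, v⟫_ℂ` is antilinear in `u`.) -/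
def trace (A : H →L[ℂ] H) : ℂ := ∑' k, ⟪onb H k, A (onb H k)⟫_ℂ

/-- Trace class operators: compact operators with `tr|A| < ∞`, where `|A| = (A* A)^{1/2}`. -/
def IsTraceClass (A : H →L[ℂ] H) : Prop :=
  IsCompactOperator A ∧ Summable fun k => ⟪onb H k, CFC.abs A (onb H k)⟫_ℂ

end Trace

/-! ### Convolutions -/

/-- The function `S ⋆ T (z) = tr(S α_z(Ť))` on phase space. -/
def opConv {d : ℕ} (S T : Op d) (z : Phase d) : ℂ := trace (S ∘L opShift z (opCheck T))

/-- `B` is the weakly defined integral `∫ f(z) α_z(S) dz`, that is,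
`⟨B ψ, ξ⟩ = ∫ f(z) ⟨α_z(S) ψ, ξ⟩ dz` for all `ψ, ξ`. -/
def IsFunOpConv {d : ℕ} (f : Phase d → ℂ) (S B : Op d) : Prop :=
  ∀ ψ ξ : L2 d, ⟪ξ, B ψ⟫_ℂ = ∫ z, f z * ⟪ξ, opShift z S ψ⟫_ℂ

theorem IsFunOpConv.unique {d : ℕ} {f : Phase d → ℂ} {S B B' : Op d}
    (h : IsFunOpConv f S B) (h' : IsFunOpConv f S B') : B = B' := by
  ext1 ψ
  exact ext_inner_left ℂ fun ξ => by rw [h ψ ξ, h' ψ ξ]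

/-! The operators `α_z(S)` depend strongly continuously on `z`, hence the weak integral exists. -/

theorem modulation_neg_cancel {d : ℕ} (ω : Rn d) (ψ : L2 d) :
    modulation ω (modulation (-ω) ψ) = ψ := by
  apply Lp.ext
  filter_upwards [coeFn_modulation ω (modulation (-ω) ψ), coeFn_modulation (-ω) ψ] with t h1 h2
  rw [h1, h2, ← mul_assoc]
  simp [character, ← Complex.exp_add, inner_neg_left]

theorem translation_neg_cancel {d : ℕ} (x : Rn d) (ψ : L2 d) :
    translation x (translation (-x) ψ) = ψ := by
  apply Lp.ext
  filter_upwards [coeFn_translation x (translation (-x) ψ),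
    (measurePreserving_sub_right volume x).quasiMeasurePreserving.ae_eq_comp
      (coeFn_translation (-x) ψ)] with t h1 h2
  rw [h1]
  simp only [Function.comp_apply] at h2
  rw [h2]
  simp

theorem norm_tfShift_apply {d : ℕ} (z : Phase d) (ψ : L2 d) : ‖tfShift z ψ‖ = ‖ψ‖ := by
  simp [tfShift]

theorem adjoint_tfShift_tfShift {d : ℕ} (z : Phase d) (ψ : L2 d) :
    ContinuousLinearMap.adjoint (tfShift z) (tfShift z ψ) = ψ := by
  refine ext_inner_left ℂ fun ξ => ?_
  rw [ContinuousLinearMap.adjoint_inner_right]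
  simp [tfShift]

theorem tfShift_adjoint_tfShift {d : ℕ} (z : Phase d) (ψ : L2 d) :
    tfShift z (ContinuousLinearMap.adjoint (tfShift z) ψ) = ψ := by
  have h : tfShift z (translation (-z.fst) (modulation (-z.snd) ψ)) = ψ := by
    simp [tfShift, translation_neg_cancel, modulation_neg_cancel]
  conv_lhs => rw [← h, adjoint_tfShift_tfShift]
  exact h

theorem norm_adjoint_tfShift_apply {d : ℕ} (z : Phase d) (ψ : L2 d) :
    ‖ContinuousLinearMap.adjoint (tfShift z) ψ‖ = ‖ψ‖ := by
  rw [← norm_tfShift_apply z, tfShift_adjoint_tfShift]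

theorem continuous_translation {d : ℕ} (ψ : L2 d) :
    Continuous fun x : Rn d => translation x ψ := by
  refine Continuous.compMeasurePreservingLp (f := fun _ : Rn d => ψ)
    (g := fun x : Rn d => (⟨fun t => t - x, by fun_prop⟩ : C(Rn d, Rn d)))
    continuous_const ?_ (fun x => measurePreserving_sub_right volume x) (by simp)
  exact ContinuousMap.continuous_of_continuous_uncurry _ (by
    simp only [Function.uncurry_def, ContinuousMap.coe_mk]
    fun_prop)

theorem continuous_modulation {d : ℕ} (ψ : L2 d) :
    Continuous fun ω : Rn d => modulation ω ψ := by
  have key : ∀ φ : L2 d, Continuous fun ω : Rn d => ⟪φ, modulation ω ψ⟫_ℂ := by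
    intro φ
    have h : ∀ ω : Rn d, ⟪φ, modulation ω ψ⟫_ℂ = ∫ t, character ω t * ⟪φ t, ψ t⟫_ℂ := by
      intro ω
      rw [L2.inner_def]
      refine integral_congr_ae ?_
      filter_upwards [coeFn_modulation ω ψ] with t ht
      rw [ht, ← smul_eq_mul (character ω t), inner_smul_right]
    simp_rw [h]
    have hi := L2.integrable_inner (𝕜 := ℂ) φ ψ
    refine continuous_of_dominated (bound := fun t => ‖⟪φ t, ψ t⟫_ℂ‖) (fun ω => ?_) (fun ω => ?_)
      hi.norm (Eventually.of_forall fun t => ?_)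
    · exact (continuous_character_right ω).aestronglyMeasurable.mul hi.aestronglyMeasurable
    · refine Eventually.of_forall fun t => ?_
      rw [norm_mul, norm_character, one_mul]
    · exact (continuous_character.comp (continuous_id.prodMk continuous_const)).mul
        continuous_const
  rw [continuous_iff_continuousAt]
  intro ω₀
  rw [ContinuousAt, tendsto_iff_norm_sub_tendsto_zero]
  have hsq : ∀ ω : Rn d, ‖modulation ω ψ - modulation ω₀ ψ‖
      = √(2 * ‖ψ‖ ^ 2 - 2 * (⟪modulation ω₀ ψ, modulation ω ψ⟫_ℂ).re) := by
    intro ω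
    rw [← Real.sqrt_sq (norm_nonneg (modulation ω ψ - modulation ω₀ ψ)),
      norm_sub_sq (𝕜 := ℂ), inner_re_symm]
    simp only [LinearIsometry.norm_map, RCLike.re_to_complex]
    congr 1
    ring
  simp_rw [hsq]
  have c : Continuous fun ω : Rn d =>
      √(2 * ‖ψ‖ ^ 2 - 2 * (⟪modulation ω₀ ψ, modulation ω ψ⟫_ℂ).re) := by
    have := Complex.continuous_re.comp (key (modulation ω₀ ψ))
    exact (continuous_const.sub (continuous_const.mul this)).sqrt
  have h0 := c.tendsto ω₀
  rw [← hsq ω₀, sub_self, norm_zero] at h0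
  exact h0

theorem continuous_tfShift {d : ℕ} (ψ : L2 d) : Continuous fun z : Phase d => tfShift z ψ := by
  rw [continuous_iff_continuousAt]
  intro z₀
  rw [ContinuousAt, tendsto_iff_norm_sub_tendsto_zero]
  have h1 : Tendsto (fun z : Phase d => ‖translation z.fst ψ - translation z₀.fst ψ‖ +
      ‖modulation z.snd (translation z₀.fst ψ) - modulation z₀.snd (translation z₀.fst ψ)‖)
      (𝓝 z₀) (𝓝 0) := by
    have c : Continuous (fun z : Phase d => ‖translation z.fst ψ - translation z₀.fst ψ‖ +
      ‖modulation z.snd (translation z₀.fst ψ) - modulation z₀.snd (translation z₀.fst ψ)‖) := by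
      have a := (continuous_translation ψ).comp (WithLp.prod_continuous_ofLp 2 (Rn d) (Rn d)).fst
      have b := (continuous_modulation (translation z₀.fst ψ)).comp
        (WithLp.prod_continuous_ofLp 2 (Rn d) (Rn d)).snd
      exact (a.sub continuous_const).norm.add (b.sub continuous_const).norm
    simpa using c.tendsto z₀
  refine squeeze_zero (fun _ => norm_nonneg _) (fun z => ?_) h1
  calc ‖tfShift z ψ - tfShift z₀ ψ‖
      = ‖modulation z.snd (translation z.fst ψ - translation z₀.fst ψ) +
          (modulation z.snd (translation z₀.fst ψ) -
            modulation z₀.snd (translation z₀.fst ψ))‖ := by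
        simp [tfShift]
    _ ≤ _ := by
        refine (norm_add_le _ _).trans ?_
        rw [LinearIsometry.norm_map]

theorem continuous_adjoint_tfShift {d : ℕ} (ψ : L2 d) :
    Continuous fun z : Phase d => ContinuousLinearMap.adjoint (tfShift z) ψ := by
  rw [continuous_iff_continuousAt]
  intro z₀
  rw [ContinuousAt, tendsto_iff_norm_sub_tendsto_zero]
  set φ := ContinuousLinearMap.adjoint (tfShift z₀) ψ with hφ
  have h : ∀ z : Phase d, ‖ContinuousLinearMap.adjoint (tfShift z) ψ - φ‖
      = ‖tfShift z₀ φ - tfShift z φ‖ := by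
    intro z
    rw [← norm_tfShift_apply z, map_sub, tfShift_adjoint_tfShift, hφ, tfShift_adjoint_tfShift]
  simp_rw [h]
  have c : Continuous fun z : Phase d => ‖tfShift z₀ φ - tfShift z φ‖ :=
    (continuous_const.sub (continuous_tfShift φ)).norm
  simpa using c.tendsto z₀

theorem norm_opShift_apply_le {d : ℕ} (z : Phase d) (S : Op d) (ψ : L2 d) :
    ‖opShift z S ψ‖ ≤ ‖S‖ * ‖ψ‖ := by
  have h : opShift z S ψ = tfShift z (S (ContinuousLinearMap.adjoint (tfShift z) ψ)) := rfl
  rw [h, norm_tfShift_apply]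
  refine (S.le_opNorm _).trans_eq ?_
  rw [norm_adjoint_tfShift_apply]

theorem continuous_opShift_apply {d : ℕ} (S : Op d) (ψ : L2 d) :
    Continuous fun z : Phase d => opShift z S ψ := by
  rw [continuous_iff_continuousAt]
  intro z₀
  rw [ContinuousAt, tendsto_iff_norm_sub_tendsto_zero]
  set φ : Phase d → L2 d := fun z => S (ContinuousLinearMap.adjoint (tfShift z) ψ) with hφ
  have hφc : Continuous φ := S.continuous.comp (continuous_adjoint_tfShift ψ)
  have c : Continuous fun z : Phase d =>
      ‖φ z - φ z₀‖ + ‖tfShift z (φ z₀) - tfShift z₀ (φ z₀)‖ :=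
    Continuous.add (hφc.sub (continuous_const (y := φ z₀))).norm
      ((continuous_tfShift (φ z₀)).sub (continuous_const (y := tfShift z₀ (φ z₀)))).norm
  have h1 : Tendsto (fun z : Phase d =>
      ‖φ z - φ z₀‖ + ‖tfShift z (φ z₀) - tfShift z₀ (φ z₀)‖) (𝓝 z₀) (𝓝 0) := by
    simpa using c.tendsto z₀
  refine squeeze_zero (fun _ => norm_nonneg _) (fun z => ?_) h1
  calc ‖opShift z S ψ - opShift z₀ S ψ‖
      = ‖tfShift z (φ z - φ z₀) + (tfShift z (φ z₀) - tfShift z₀ (φ z₀))‖ := by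
        rw [map_sub, sub_add_sub_cancel]; rfl
    _ ≤ _ := by
        refine (norm_add_le _ _).trans ?_
        rw [norm_tfShift_apply]

theorem integrable_smul_opShift {d : ℕ} {f : Phase d → ℂ} (hf : Integrable f) (S : Op d)
    (ψ : L2 d) : Integrable fun z => f z • opShift z S ψ := by
  refine (hf.norm.mul_const (‖S‖ * ‖ψ‖)).mono'
    (hf.aestronglyMeasurable.smul (continuous_opShift_apply S ψ).aestronglyMeasurable)
    (Eventually.of_forall fun z => ?_)
  rw [norm_smul]
  exact mul_le_mul_of_nonneg_left (norm_opShift_apply_le z S ψ) (norm_nonneg _)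

theorem exists_isFunOpConv {d : ℕ} {f : Phase d → ℂ} (hf : Integrable f) (S : Op d) :
    ∃ B : Op d, IsFunOpConv f S B := by
  refine ⟨LinearMap.mkContinuous
    { toFun := fun ψ => ∫ z, f z • opShift z S ψ
      map_add' := fun ψ φ => ?_
      map_smul' := fun c ψ => ?_ } ((∫ z, ‖f z‖) * ‖S‖) fun ψ => ?_, fun ψ ξ => ?_⟩
  · simp_rw [map_add, smul_add]
    exact integral_add (integrable_smul_opShift hf S ψ) (integrable_smul_opShift hf S φ)
  · simp_rw [map_smul, smul_comm _ c]
    exact integral_smul c _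
  · change ‖∫ z, f z • opShift z S ψ‖ ≤ _
    rw [mul_assoc, ← integral_mul_const]
    refine norm_integral_le_of_norm_le (hf.norm.mul_const _) (Eventually.of_forall fun z => ?_)
    rw [norm_smul]
    exact mul_le_mul_of_nonneg_left (norm_opShift_apply_le z S ψ) (norm_nonneg _)
  · change ⟪ξ, ∫ z, f z • opShift z S ψ⟫_ℂ = _
    rw [← integral_inner (integrable_smul_opShift hf S ψ) ξ]
    simp_rw [inner_smul_right]

open Classical in
/-- The operator `f ⋆ S = ∫ f(z) α_z(S) dz`, the integral being taken in the weak sense. -/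
def funOpConv {d : ℕ} (f : Phase d → ℂ) (S : Op d) : Op d :=
  if h : ∃ B : Op d, IsFunOpConv f S B then h.choose else 0

theorem funOpConv_spec {d : ℕ} {f : Phase d → ℂ} (hf : Integrable f) (S : Op d) :
    IsFunOpConv f S (funOpConv f S) := by
  have h := exists_isFunOpConv hf S
  rw [funOpConv, dif_pos h]
  exact h.choose_spec

/-! ### Cohen class distributions and mixed-state localization operators -/

/-- The complex-valued characteristic function `χ_Ω`. -/
def chi {d : ℕ} (Ω : Set (Phase d)) : Phase d → ℂ := Ω.indicator fun _ => 1

/-- The mixed-state localization operator `χ_Ω ⋆ S`. -/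
def locOp {d : ℕ} (Ω : Set (Phase d)) (S : Op d) : Op d := funOpConv (chi Ω) S

/-- The Cohen class distribution `Q_S(ψ) = Š ⋆ (ψ ⊗ ψ)`, where `(ψ ⊗ ψ) ξ = ⟨ξ, ψ⟩ ψ`. -/
def cohen {d : ℕ} (S : Op d) (ψ : L2 d) : Phase d → ℂ :=
  opConv (opCheck S) (InnerProductSpace.rankOne ℂ ψ ψ)

/-- The function `S̃ = S ⋆ Š`. -/
def opTilde {d : ℕ} (S : Op d) : Phase d → ℂ := opConv S (opCheck S)

/-- A spectral representation `T = ∑ₖ λₖ hₖ ⊗ hₖ` with `λ₀ ≥ λ₁ ≥ ⋯` and orthonormal eigenfunctions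
`hₖ`. (The system `h` need not be complete: if `T` has infinite rank and a nontrivial kernel, a
decreasing enumeration of the eigenvalues by `ℕ` never reaches the eigenvalue `0`.) -/
structure IsSpectralRep {d : ℕ} (T : Op d) (lam : ℕ → ℝ) (h : ℕ → L2 d) : Prop where
  antitone : Antitone lam
  orthonormal : Orthonormal ℂ h
  hasSum : ∀ ψ : L2 d, HasSum (fun k => (lam k : ℂ) • InnerProductSpace.rankOne ℂ (h k) (h k) ψ) (T ψ)

/-- The accumulated Cohen class distribution `ρ_Ω^S = ∑_{k=1}^{A_Ω} Q_S(h_k)`, `A_Ω = ⌈|Ω|⌉`, formed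
with the eigenfunctions `h` of `χ_Ω ⋆ S` (numbered from `0` here). -/
def accumulatedCohen {d : ℕ} (Ω : Set (Phase d)) (S : Op d) (h : ℕ → L2 d) (z : Phase d) : ℂ :=
  ∑ k ∈ Finset.range ⌈volume.real Ω⌉₊, cohen S (h k) z

/-! ### The class `M*_op` -/

/-- `M*_op`: positive trace class operators with `tr(S) = 1` and `∫ S̃(z) |z| dz < ∞`. (The function
`S̃` is real-valued and nonnegative when `S ≥ 0`.) -/
structure MemMop {d : ℕ} (S : Op d) : Prop where
  traceClass : IsTraceClass S
  isPositive : S.IsPositive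
  trace_eq_one : trace S = 1
  integrable : Integrable fun z : Phase d => (opTilde S z).re * ‖z‖

/-- `‖S‖_{M*_op} = (∫ S̃(z) |z| dz)^{1/2}`. -/
def mopNorm {d : ℕ} (S : Op d) : ℝ := √(∫ z : Phase d, (opTilde S z).re * ‖z‖)

/-! ### Variation and perimeter -/

section Variation

variable {V : Type*} [NormedAddCommGroup V] [InnerProductSpace ℝ V] [FiniteDimensional ℝ V]
  [MeasurableSpace V] [BorelSpace V]

/-- The divergence of a vector field. -/
def divergence (F : V → V) (x : V) : ℝ := LinearMap.trace ℝ V (fderiv ℝ F x : V →ₗ[ℝ] V)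

/-- The variation `Var(f) = sup { ∫ f div F : F ∈ C_c¹(V, V), |F| ≤ 1 }` of a function on a Euclidean
space. -/
def variation (f : V → ℝ) : ℝ≥0∞ :=
  ⨆ (F : V → V) (_ : ContDiff ℝ 1 F) (_ : HasCompactSupport F) (_ : ∀ x, ‖F x‖ ≤ 1),
    ENNReal.ofReal (∫ x, f x * divergence F x)

/-- The perimeter `|∂Ω| = Var(χ_Ω)`. -/
def perimeter (Ω : Set V) : ℝ≥0∞ := variation (Ω.indicator fun _ => (1 : ℝ))

end Variation

end QHA

end

open QHA

/-!
Write `S = ∑ₖ rₖ ⊗ rₖ` with `rₖ = S^{1/2} eₖ` for an orthonormal basis `e`; then `∑ₖ ‖rₖ‖² = 1` and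
`Q_S(ψ)(z) = ⟨α_z(S) ψ, ψ⟩ = ∑ₖ |⟨π(z) rₖ, ψ⟩|²` (`cohen_eq_inner`, `ofReal_cohenReal`). Moyal's
identity (`lintegral_enorm_inner_tfShift_sq`) gives `∫ Q_S(ψ) = ‖ψ‖²` and `∫ S̃ = 1`, and Bessel's
inequality gives `0 ≤ ρ ≤ 1` for the accumulated distribution `ρ` (`tsum_cohenReal_le`). Moreover
`λ_k = ∫_Ω Q_S(h_k)` (`eigenvalue_eq`). With `N = ⌈|Ω|⌉` it follows that
`‖ρ - χ_Ω‖₁ = N + |Ω| - 2 ∑_{k < N} λ_k ≤ 1 + 2 (|Ω| - ∑_{k < N} λ_k)`, where the eigenvalues are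
numbered from `0`, and `1 ≤ |∂Ω| / ε`.

The eigenvalues decrease in `[0, 1]` and have sum at most `|Ω| ≤ N`, which forces
`∑ₖ λ_k² ≤ ∑_{k < N} λ_k` (`tsum_sq_le_sum_range`), so it remains to bound `|Ω| - ∑ₖ λ_k²`. Since
`∑ₖ λ_k² = tr((χ_Ω ⋆ S)²) = ∫_Ω ∫_Ω S̃(z' - z) dz' dz` and `∫ S̃ = 1`, this difference is
`∫ S̃(w) |Ω \ (Ω - w)| dw` (`volume_eq_add_lintegral`). Testing the definition of the perimeter with
translates of a smooth approximation of `χ_{Ω \ (Ω - w)}` shows that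
`|Ω \ (Ω - w)| ≤ |w| |∂Ω|` (`volume_diff_preimage_add_le`), and the integral is at most
`‖S‖² |∂Ω|` in the norm of `M*_op`. All sums and integrals of nonnegative terms are taken in `ℝ≥0∞`,
where they may be interchanged freely.
-/

open scoped FourierTransform ComplexConjugate

namespace QHA

/-! ### Plancherel's theorem and Moyal's identity -/

section Plancherel

variable {E : Type*} [NormedAddCommGroup E] [InnerProductSpace ℝ E] [FiniteDimensional ℝ E]
  [MeasurableSpace E] [BorelSpace E]

/-- On `L¹ ∩ L²` the Fourier transform of `L²` is given by the Fourier integral: both have the same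
pairings with test functions. -/
theorem coeFn_fourier_toLp {g : E → ℂ} (h1 : Integrable g) (h2 : MemLp g 2) :
    (𝓕 (h2.toLp g) : Lp ℂ 2 (volume : Measure E)) =ᵐ[volume] 𝓕 g := by
  have hc : Continuous (𝓕 g) :=
    VectorFourier.fourierIntegral_continuous Real.continuous_fourierChar
      (by exact continuous_inner) h1
  refine ae_eq_of_integral_contDiff_smul_eq
    ((Lp.memLp _).locallyIntegrable (by norm_num)) hc.locallyIntegrable fun φ hφ hφc => ?_
  have hs : ContDiff ℝ ((⊤ : ℕ∞) : WithTop ℕ∞) fun x => (φ x : ℂ) :=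
    Complex.ofRealCLM.contDiff.comp hφ
  have hsc : HasCompactSupport fun x => (φ x : ℂ) := hφc.comp_left (g := fun t : ℝ => (t : ℂ)) rfl
  set Φ : SchwartzMap E ℂ := hsc.toSchwartzMap hs with hΦ
  have hΦa : ∀ x, Φ x = (φ x : ℂ) := fun x => rfl
  have k := congrArg (fun T => T Φ) (Lp.fourier_toTemperedDistribution_eq (h2.toLp g))
  simp only [TemperedDistribution.fourier_apply, Lp.toTemperedDistribution_apply] at k
  have k2 := VectorFourier.integral_fourierIntegral_smul_eq_flip (μ := volume) (ν := volume)
    (L := innerₗ E) Real.continuous_fourierChar continuous_inner h1 (Φ.integrable (μ := volume))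
  rw [flip_innerₗ] at k2
  calc ∫ x, φ x • (𝓕 (h2.toLp g) : Lp ℂ 2 (volume : Measure E)) x
      = ∫ x, Φ x • (𝓕 (h2.toLp g) : Lp ℂ 2 (volume : Measure E)) x := by
        simp [hΦa]
    _ = ∫ x, (𝓕 Φ : SchwartzMap E ℂ) x • h2.toLp g x := k.symm
    _ = ∫ x, g x • 𝓕 (Φ : E → ℂ) x := by
        refine integral_congr_ae ?_
        filter_upwards [h2.coeFn_toLp] with x hx
        rw [hx, SchwartzMap.fourier_coe, smul_eq_mul, smul_eq_mul, mul_comm]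
    _ = ∫ x, 𝓕 g x • Φ x := k2.symm
    _ = _ := by simp [hΦa, mul_comm]

theorem enorm_sq_eq_lintegral {α : Type*} [MeasurableSpace α] {μ : Measure α} (f : Lp ℂ 2 μ) :
    ‖f‖ₑ ^ 2 = ∫⁻ t, ‖f t‖ₑ ^ 2 ∂μ := by
  have := eLpNorm_nnreal_pow_eq_lintegral (f := f) (μ := μ) (p := 2) (by norm_num)
  rw [Lp.enorm_def]
  simpa using this

/-- Plancherel's theorem for the Fourier integral of a function in `L¹ ∩ L²`. -/
theorem lintegral_enorm_fourier_sq {g : E → ℂ} (h1 : Integrable g) (h2 : MemLp g 2) :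
    ∫⁻ w, ‖𝓕 g w‖ₑ ^ 2 = ∫⁻ v, ‖g v‖ₑ ^ 2 := by
  calc ∫⁻ w, ‖𝓕 g w‖ₑ ^ 2
      = ∫⁻ w, ‖(𝓕 (h2.toLp g) : Lp ℂ 2 (volume : Measure E)) w‖ₑ ^ 2 := by
        refine lintegral_congr_ae ?_
        filter_upwards [coeFn_fourier_toLp h1 h2] with w hw
        rw [hw]
    _ = ‖h2.toLp g‖ₑ ^ 2 := by
        rw [← enorm_sq_eq_lintegral, ← ofReal_norm, Lp.norm_fourier_eq, ofReal_norm]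
    _ = ∫⁻ v, ‖g v‖ₑ ^ 2 := by
        rw [enorm_sq_eq_lintegral]
        refine lintegral_congr_ae ?_
        filter_upwards [h2.coeFn_toLp] with w hw
        rw [hw]

end Plancherel

theorem coeFn_tfShift {d : ℕ} (z : Phase d) (r : L2 d) :
    tfShift z r =ᵐ[volume] fun t => character z.snd t * r (t - z.fst) := by
  filter_upwards [coeFn_modulation z.snd (translation z.fst r), coeFn_translation z.fst r]
    with t h1 h2
  change modulation z.snd (translation z.fst r) t = _
  rw [h1, h2]

theorem inner_tfShift_eq_fourier {d : ℕ} (x ω : Rn d) (r ψ : L2 d) :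
    ⟪tfShift (WithLp.toLp 2 (x, ω)) r, ψ⟫_ℂ = 𝓕 (fun t => ψ t * conj (r (t - x))) ω := by
  rw [L2.inner_def, Real.fourier_eq']
  refine integral_congr_ae ?_
  filter_upwards [coeFn_tfShift (WithLp.toLp 2 (x, ω)) r] with t ht
  rw [ht]
  have : conj (character ω t) = Complex.exp (↑(-2 * Real.pi * ⟪t, ω⟫_ℝ) * Complex.I) := by
    rw [character, ← Complex.exp_conj]
    congr 1
    simp only [map_mul, Complex.conj_I, Complex.conj_ofReal, map_ofNat]
    rw [real_inner_comm]
    push_cast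
    ring
  change ⟪character ω t * r (t - x), ψ t⟫_ℂ = _
  rw [RCLike.inner_apply, map_mul, smul_eq_mul, ← this]
  ring

/-- Moyal's identity: `z ↦ ⟨π(z) r, ψ⟩` has `L²` norm `‖r‖ ‖ψ‖`. For fixed `x` it is the Fourier
transform of `ψ · conj (r (· - x))`, so Plancherel's theorem reduces it to Tonelli's theorem. -/
theorem lintegral_enorm_inner_tfShift_sq {d : ℕ} (r ψ : L2 d) :
    ∫⁻ z : Phase d, ‖⟪tfShift z r, ψ⟫_ℂ‖ₑ ^ 2 = ‖r‖ₑ ^ 2 * ‖ψ‖ₑ ^ 2 := by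
  have hm : Measurable fun z : Phase d => ‖⟪tfShift z r, ψ⟫_ℂ‖ₑ ^ 2 :=
    (((continuous_tfShift r).inner continuous_const).enorm.measurable).pow_const 2
  have hr := (Lp.stronglyMeasurable r).measurable
  have hψ := (Lp.stronglyMeasurable ψ).measurable
  have hgm : Measurable fun p : Rn d × Rn d => ψ p.2 * conj (r (p.2 - p.1)) := by fun_prop
  have hx : ∀ x : Rn d, ∫⁻ t, ‖ψ t‖ₑ ^ 2 * ‖r (t - x)‖ₑ ^ 2
      = ∫⁻ t, ‖ψ t * conj (r (t - x))‖ₑ ^ 2 := by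
    intro x
    refine lintegral_congr fun t => ?_
    rw [enorm_mul, mul_pow, RCLike.enorm_conj]
  have hF : ∫⁻ x : Rn d, ∫⁻ t, ‖ψ t * conj (r (t - x))‖ₑ ^ 2 = ‖r‖ₑ ^ 2 * ‖ψ‖ₑ ^ 2 := by
    simp_rw [← hx]
    rw [lintegral_lintegral_swap (by fun_prop)]
    have : ∀ t : Rn d, ∫⁻ x, ‖ψ t‖ₑ ^ 2 * ‖r (t - x)‖ₑ ^ 2 = ‖ψ t‖ₑ ^ 2 * ‖r‖ₑ ^ 2 := by
      intro t
      rw [lintegral_const_mul _ (by fun_prop), enorm_sq_eq_lintegral r,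
        lintegral_sub_left_eq_self (fun s => ‖r s‖ₑ ^ 2) t]
    simp_rw [this]
    rw [lintegral_mul_const _ (by fun_prop), ← enorm_sq_eq_lintegral, mul_comm]
  -- the product `ψ · conj (r (· - x))` is in `L¹` for every `x`, but need not be in `L²` for all `x`
  have hfin : ∀ᵐ x : Rn d, ∫⁻ t, ‖ψ t * conj (r (t - x))‖ₑ ^ 2 < ∞ := by
    refine ae_lt_top ?_ ?_
    · exact ((hgm.enorm.pow_const 2)).lintegral_prod_right'
    · rw [hF]
      exact ENNReal.mul_ne_top (by simp) (by simp)
  calc ∫⁻ z : Phase d, ‖⟪tfShift z r, ψ⟫_ℂ‖ₑ ^ 2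
      = ∫⁻ p : Rn d × Rn d, ‖⟪tfShift (WithLp.toLp 2 p) r, ψ⟫_ℂ‖ₑ ^ 2 :=
        ((WithLp.volume_preserving_toLp (Rn d) (Rn d)).lintegral_comp hm).symm
    _ = ∫⁻ x : Rn d, ∫⁻ ω : Rn d, ‖⟪tfShift (WithLp.toLp 2 (x, ω)) r, ψ⟫_ℂ‖ₑ ^ 2 := by
        rw [Measure.volume_eq_prod, lintegral_prod]
        exact (hm.comp (WithLp.measurable_toLp 2 _)).aemeasurable
    _ = ∫⁻ x : Rn d, ∫⁻ t, ‖ψ t * conj (r (t - x))‖ₑ ^ 2 := by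
        refine lintegral_congr_ae ?_
        filter_upwards [hfin] with x hxf
        simp_rw [inner_tfShift_eq_fourier]
        have hmx : AEStronglyMeasurable (fun t => ψ t * conj (r (t - x))) volume :=
          (hgm.comp measurable_prodMk_left).aestronglyMeasurable
        refine lintegral_enorm_fourier_sq ?_ ?_
        · have h := L2.integrable_inner (𝕜 := ℂ) (translation x r) ψ
          refine h.congr ?_
          filter_upwards [coeFn_translation x r] with t ht
          rw [ht, RCLike.inner_apply]
        · refine ⟨hmx, ?_⟩
          rw [eLpNorm_lt_top_iff_lintegral_rpow_enorm_lt_top (by norm_num) (by norm_num)]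
          simpa using hxf
    _ = _ := hF

/-! ### Orthonormal families and the trace of a product of positive operators -/

section Hilbert

variable {H : Type*} [NormedAddCommGroup H] [InnerProductSpace ℂ H]

theorem ofReal_norm_sq {H : Type*} [NormedAddCommGroup H] (x : H) :
    ENNReal.ofReal (‖x‖ ^ 2) = ‖x‖ₑ ^ 2 := by
  rw [ENNReal.ofReal_pow (norm_nonneg _), ofReal_norm]

/-- Parseval's identity in `ℝ≥0∞`. -/
theorem tsum_enorm_inner_sq {ι : Type*} (b : HilbertBasis ι ℂ H) (x : H) :
    ∑' i, ‖⟪b i, x⟫_ℂ‖ₑ ^ 2 = ‖x‖ₑ ^ 2 := by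
  have h := b.hasSum_inner_mul_inner x x
  have h2 : HasSum (fun i => ‖⟪b i, x⟫_ℂ‖ ^ 2) (‖x‖ ^ 2) := by
    have hf : (fun i => ⟪x, b i⟫_ℂ * ⟪b i, x⟫_ℂ) = fun i => ((‖⟪b i, x⟫_ℂ‖ ^ 2 : ℝ) : ℂ) := by
      funext i
      rw [← inner_conj_symm, mul_comm, Complex.mul_conj, Complex.normSq_eq_norm_sq]
    have hx : ⟪x, x⟫_ℂ = ((‖x‖ ^ 2 : ℝ) : ℂ) := by
      rw [inner_self_eq_norm_sq_to_K]; simp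
    rw [hf, hx] at h
    exact Complex.hasSum_ofReal.1 h
  simp_rw [← ofReal_norm_sq]
  rw [← h2.tsum_eq, ENNReal.ofReal_tsum_of_nonneg (fun _ => by positivity) h2.summable]

/-- Bessel's inequality in `ℝ≥0∞`. -/
theorem tsum_enorm_inner_sq_le {ι : Type*} {h : ι → H} (hh : Orthonormal ℂ h) (x : H) :
    ∑' i, ‖⟪h i, x⟫_ℂ‖ₑ ^ 2 ≤ ‖x‖ₑ ^ 2 := by
  simp_rw [← ofReal_norm_sq]
  rw [← ENNReal.ofReal_tsum_of_nonneg (fun _ => by positivity) (hh.inner_products_summable x)]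
  exact ENNReal.ofReal_le_ofReal (hh.tsum_inner_products_le x)

/-- The vectors of an orthonormal family have mutual distance `√2`, so a separable space contains
only countably many of them. -/
theorem countable_of_orthonormal [TopologicalSpace.SeparableSpace H] {ι : Type*} {h : ι → H}
    (hh : Orthonormal ℂ h) : Countable ι := by
  have hd : ∀ i j, i ≠ j → 1 ≤ dist (h i) (h j) := by
    intro i j hij
    rw [dist_eq_norm, ← Real.sqrt_sq (norm_nonneg (h i - h j)), Real.one_le_sqrt,
      norm_sub_sq (𝕜 := ℂ), hh.1, hh.1, hh.2 hij]
    norm_num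
  obtain ⟨D, hDc, hDd⟩ := TopologicalSpace.exists_countable_dense H
  have : ∀ i, ∃ x ∈ D, dist (h i) x < 1 / 2 := fun i => hDd.exists_dist_lt (h i) (by norm_num)
  choose g hg hgd using this
  have := hDc.to_subtype
  refine Function.Injective.countable (f := fun i => (⟨g i, hg i⟩ : D)) fun i j hij => ?_
  by_contra hne
  have hij' : g i = g j := congrArg Subtype.val hij
  have h1 := hd i j hne
  have h2 := dist_triangle_right (h i) (h j) (g i)
  have h3 := hgd i
  have h4 := hgd j
  rw [← hij'] at h4
  linarith

theorem inner_eq_ofReal_of_isPositive [CompleteSpace H] {A : H →L[ℂ] H} (hA : A.IsPositive)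
    (x : H) : ⟪x, A x⟫_ℂ = ((⟪x, A x⟫_ℂ).re : ℂ) := by
  have := (Complex.nonneg_iff.1 (hA.inner_nonneg_right x)).2
  exact Complex.ext rfl (by simp [← this])

theorem re_inner_nonneg [CompleteSpace H] {A : H →L[ℂ] H} (hA : A.IsPositive) (x : H) :
    0 ≤ (⟪x, A x⟫_ℂ).re :=
  (Complex.nonneg_iff.1 (hA.inner_nonneg_right x)).1

variable [CompleteSpace H]

theorem trace_comp_rankOne (A : H →L[ℂ] H) (φ : H) :
    trace (A ∘L InnerProductSpace.rankOne ℂ φ φ) = ⟪φ, A φ⟫_ℂ := by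
  rw [trace, ← (onb H).tsum_inner_mul_inner]
  refine tsum_congr fun k => ?_
  simp

/-- The vectors `rₖ = S^{1/2} eₖ`, for which `S = ∑ₖ rₖ ⊗ rₖ` if `S` is positive. -/
noncomputable def sqrtVec (S : H →L[ℂ] H) (k : (exists_hilbertBasis ℂ H).choose) : H :=
  CFC.sqrt S (onb H k)

section Positive

variable {S : H →L[ℂ] H}

theorem inner_sqrt_left (x y : H) : ⟪CFC.sqrt S x, y⟫_ℂ = ⟪x, CFC.sqrt S y⟫_ℂ := by
  have h : (CFC.sqrt S).IsPositive :=
    (ContinuousLinearMap.nonneg_iff_isPositive _).1 (CFC.sqrt_nonneg S)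
  exact h.isSymmetric x y

theorem sqrt_sqrt_apply (hS : S.IsPositive) (x : H) : CFC.sqrt S (CFC.sqrt S x) = S x := by
  have h := CFC.sqrt_mul_sqrt_self S ((ContinuousLinearMap.nonneg_iff_isPositive _).2 hS)
  exact congrArg (fun A : H →L[ℂ] H => A x) h

/-- The expansion `S = ∑ₖ rₖ ⊗ rₖ` as an identity of quadratic forms. -/
theorem ofReal_re_inner_eq_tsum (hS : S.IsPositive) (ψ : H) :
    ENNReal.ofReal (⟪ψ, S ψ⟫_ℂ).re = ∑' k, ‖⟪sqrtVec S k, ψ⟫_ℂ‖ₑ ^ 2 := by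
  have hψ : ⟪ψ, S ψ⟫_ℂ = ((‖CFC.sqrt S ψ‖ ^ 2 : ℝ) : ℂ) := by
    rw [← sqrt_sqrt_apply hS, ← inner_sqrt_left, inner_self_eq_norm_sq_to_K]
    norm_cast
  simp_rw [sqrtVec, inner_sqrt_left]
  rw [tsum_enorm_inner_sq, hψ, Complex.ofReal_re, ofReal_norm_sq]

theorem hasSum_norm_sqrtVec_sq (hS : S.IsPositive) (htr : trace S = 1) :
    HasSum (fun k => ‖sqrtVec S k‖ ^ 2) 1 := by
  have hk : ∀ k, ⟪onb H k, S (onb H k)⟫_ℂ = ((‖sqrtVec S k‖ ^ 2 : ℝ) : ℂ) := by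
    intro k
    rw [← sqrt_sqrt_apply hS, ← inner_sqrt_left, inner_self_eq_norm_sq_to_K, sqrtVec]
    norm_cast
  rw [trace] at htr
  simp_rw [hk] at htr
  -- a nonzero value of `∑'` certifies summability
  have hs : Summable fun k => ((‖sqrtVec S k‖ ^ 2 : ℝ) : ℂ) := by
    by_contra h
    rw [tsum_eq_zero_of_not_summable h] at htr
    exact zero_ne_one htr
  have := hs.hasSum
  rw [htr] at this
  exact Complex.hasSum_ofReal.1 (by rwa [Complex.ofReal_one])

theorem tsum_enorm_sqrtVec_sq (hS : S.IsPositive) (htr : trace S = 1) :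
    ∑' k, ‖sqrtVec S k‖ₑ ^ 2 = 1 := by
  have h := hasSum_norm_sqrtVec_sq hS htr
  simp_rw [← ofReal_norm_sq]
  rw [← ENNReal.ofReal_tsum_of_nonneg (fun _ => by positivity) h.summable, h.tsum_eq,
    ENNReal.ofReal_one]

theorem summable_re_inner_sqrtVec (hS : S.IsPositive) (htr : trace S = 1) (A : H →L[ℂ] H) :
    Summable fun k => (⟪sqrtVec S k, A (sqrtVec S k)⟫_ℂ).re := by
  refine Summable.of_norm_bounded ((hasSum_norm_sqrtVec_sq hS htr).summable.mul_left ‖A‖)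
    fun k => ?_
  calc ‖(⟪sqrtVec S k, A (sqrtVec S k)⟫_ℂ).re‖ ≤ ‖⟪sqrtVec S k, A (sqrtVec S k)⟫_ℂ‖ :=
        Complex.abs_re_le_norm _
    _ ≤ ‖sqrtVec S k‖ * ‖A (sqrtVec S k)‖ := norm_inner_le_norm _ _
    _ ≤ ‖sqrtVec S k‖ * (‖A‖ * ‖sqrtVec S k‖) := by gcongr; exact A.le_opNorm _
    _ = ‖A‖ * ‖sqrtVec S k‖ ^ 2 := by ring

/-- Cyclicity of the trace in the form `tr(S A) = tr(S^{1/2} A S^{1/2})`: expanding both sides in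
the basis gives the same double series, which converges absolutely because `S^{1/2}` is
Hilbert–Schmidt. -/
theorem trace_comp_eq_tsum (hS : S.IsPositive) (htr : trace S = 1) {A : H →L[ℂ] H}
    (hA : A.IsPositive) :
    trace (S ∘L A) = ∑' k, ⟪sqrtVec S k, A (sqrtVec S k)⟫_ℂ := by
  set e := onb H with he
  set f := fun k l => ⟪sqrtVec S k, e l⟫_ℂ * ⟪e l, CFC.sqrt S (A (e k))⟫_ℂ with hf
  have hsumm : ∀ {g : (exists_hilbertBasis ℂ H).choose → (exists_hilbertBasis ℂ H).choose → ℂ},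
      ∑' k, ∑' l, ‖g k l‖ₑ ^ 2 ≠ ∞ → Summable fun p : _ × _ => ‖g p.1 p.2‖ ^ 2 := by
    intro g hg
    rw [← ENNReal.tsum_prod] at hg
    refine (ENNReal.summable_toReal hg).congr fun p => ?_
    simp
  -- both factors of the double series are square summable over all pairs `(k, l)`
  have ha : Summable fun p : _ × _ => ‖⟪sqrtVec S p.1, e p.2⟫_ℂ‖ ^ 2 := by
    refine hsumm (g := fun k l => ⟪sqrtVec S k, e l⟫_ℂ) ?_
    have : ∀ k, ∑' l, ‖⟪sqrtVec S k, e l⟫_ℂ‖ₑ ^ 2 = ‖sqrtVec S k‖ₑ ^ 2 := by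
      intro k
      rw [← tsum_enorm_inner_sq e]
      refine tsum_congr fun l => ?_
      rw [← inner_conj_symm, RCLike.enorm_conj]
    simp_rw [this]
    rw [tsum_enorm_sqrtVec_sq hS htr]
    exact ENNReal.one_ne_top
  have hflip : ∀ k l, ⟪e l, CFC.sqrt S (A (e k))⟫_ℂ = ⟪A (sqrtVec S l), e k⟫_ℂ := by
    intro k l
    rw [← inner_sqrt_left]
    exact (hA.isSymmetric _ _).symm
  have hb : Summable fun p : _ × _ => ‖⟪e p.2, CFC.sqrt S (A (e p.1))⟫_ℂ‖ ^ 2 := by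
    refine hsumm (g := fun k l => ⟪e l, CFC.sqrt S (A (e k))⟫_ℂ) ?_
    rw [ENNReal.tsum_comm]
    have : ∀ l, ∑' k, ‖⟪e l, CFC.sqrt S (A (e k))⟫_ℂ‖ₑ ^ 2 = ‖A (sqrtVec S l)‖ₑ ^ 2 := by
      intro l
      rw [← tsum_enorm_inner_sq e]
      refine tsum_congr fun k => ?_
      rw [hflip, ← inner_conj_symm, RCLike.enorm_conj]
    simp_rw [this]
    refine ne_top_of_le_ne_top (b := ‖A‖ₑ ^ 2 * 1) (by simp) ?_
    rw [← tsum_enorm_sqrtVec_sq hS htr, ← ENNReal.tsum_mul_left]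
    refine ENNReal.tsum_le_tsum fun l => ?_
    rw [← mul_pow]
    gcongr
    exact A.le_opENorm _
  have hfs : Summable (Function.uncurry f) := by
    refine Summable.of_norm_bounded (ha.add hb) fun p => ?_
    change ‖_ * _‖ ≤ _
    rw [norm_mul]
    nlinarith [sq_nonneg (‖⟪sqrtVec S p.1, e p.2⟫_ℂ‖ - ‖⟪e p.2, CFC.sqrt S (A (e p.1))⟫_ℂ‖),
      sq_nonneg ‖⟪sqrtVec S p.1, e p.2⟫_ℂ‖, sq_nonneg ‖⟪e p.2, CFC.sqrt S (A (e p.1))⟫_ℂ‖]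
  calc trace (S ∘L A) = ∑' k, ∑' l, f k l := by
        refine tsum_congr fun k => ?_
        rw [hf, e.tsum_inner_mul_inner, ContinuousLinearMap.comp_apply, ← sqrt_sqrt_apply hS,
          ← inner_sqrt_left, sqrtVec]
    _ = ∑' l, ∑' k, f k l := hfs.tsum_comm.symm
    _ = _ := by
        refine tsum_congr fun l => ?_
        have h1 : ⟪sqrtVec S l, A (sqrtVec S l)⟫_ℂ = ⟪A (sqrtVec S l), sqrtVec S l⟫_ℂ :=
          (hA.isSymmetric _ _).symm
        rw [h1, ← e.tsum_inner_mul_inner]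
        refine tsum_congr fun k => ?_
        rw [hf]
        simp only
        rw [hflip, mul_comm]
        congr 1
        exact inner_sqrt_left _ _

theorem ofReal_re_trace_comp (hS : S.IsPositive) (htr : trace S = 1) {A : H →L[ℂ] H}
    (hA : A.IsPositive) :
    ENNReal.ofReal (trace (S ∘L A)).re
      = ∑' k, ENNReal.ofReal (⟪sqrtVec S k, A (sqrtVec S k)⟫_ℂ).re := by
  rw [trace_comp_eq_tsum hS htr hA,
    tsum_congr fun k => inner_eq_ofReal_of_isPositive hA (sqrtVec S k), ← Complex.ofReal_tsum,
    Complex.ofReal_re, ENNReal.ofReal_tsum_of_nonneg (fun k => re_inner_nonneg hA _)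
      (summable_re_inner_sqrtVec hS htr A)]

theorem re_trace_comp_nonneg (hS : S.IsPositive) (htr : trace S = 1) {A : H →L[ℂ] H}
    (hA : A.IsPositive) :
    0 ≤ (trace (S ∘L A)).re := by
  rw [trace_comp_eq_tsum hS htr hA,
    tsum_congr fun k => inner_eq_ofReal_of_isPositive hA (sqrtVec S k), ← Complex.ofReal_tsum,
    Complex.ofReal_re]
  exact tsum_nonneg fun k => re_inner_nonneg hA _

end Positive

end Hilbert

/-! ### Phase-space shifts and the Cohen class distribution -/

variable {d : ℕ}

/-- Composition of time-frequency shifts is a shift up to a phase factor. -/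
theorem tfShift_tfShift (z w : Phase d) (f : L2 d) :
    tfShift z (tfShift w f) = character w.snd (-z.fst) • tfShift (z + w) f := by
  apply Lp.ext
  filter_upwards [coeFn_tfShift z (tfShift w f), Lp.coeFn_smul (character w.snd (-z.fst))
      (tfShift (z + w) f), coeFn_tfShift (z + w) f,
    (measurePreserving_sub_right volume z.fst).quasiMeasurePreserving.ae_eq_comp
      (coeFn_tfShift w f)] with t h1 h2 h3 h4
  rw [h1, h2, Pi.smul_apply, h3]
  simp only [Function.comp_apply] at h4
  rw [h4, smul_eq_mul, WithLp.add_fst, WithLp.add_snd]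
  have hc : character z.snd t * character w.snd (t - z.fst)
      = character w.snd (-z.fst) * character (z.snd + w.snd) t := by
    simp only [character, ← Complex.exp_add, inner_add_left, inner_sub_right, inner_neg_right]
    congr 1
    push_cast
    ring
  rw [← mul_assoc, hc, mul_assoc, sub_sub]

theorem tfShift_zero (f : L2 d) : tfShift (0 : Phase d) f = f := by
  apply Lp.ext
  filter_upwards [coeFn_tfShift (0 : Phase d) f] with t h
  simp [h, character]

theorem inner_tfShift_tfShift (z : Phase d) (f g : L2 d) :
    ⟪tfShift z f, tfShift z g⟫_ℂ = ⟪f, g⟫_ℂ := by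
  rw [← ContinuousLinearMap.adjoint_inner_right, adjoint_tfShift_tfShift]

/-- Covariance: up to a phase, `π(z)* π(w)` is `π(w - z)`. -/
theorem norm_inner_tfShift_tfShift (z w : Phase d) (f g : L2 d) :
    ‖⟪tfShift w f, tfShift z g⟫_ℂ‖ = ‖⟪tfShift (w - z) f, g⟫_ℂ‖ := by
  rw [← inner_tfShift_tfShift z (tfShift (w - z) f) g, tfShift_tfShift, inner_smul_left, norm_mul,
    RCLike.norm_conj, norm_character, one_mul, add_sub_cancel]

theorem coeFn_parity (f : L2 d) : parity d f =ᵐ[volume] fun t => f (-t) :=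
  Lp.coeFn_compMeasurePreserving f (Measure.measurePreserving_neg volume)

theorem parity_parity (f : L2 d) : parity d (parity d f) = f := by
  apply Lp.ext
  filter_upwards [coeFn_parity (parity d f),
    (Measure.measurePreserving_neg (volume : Measure (Rn d))).quasiMeasurePreserving.ae_eq_comp
      (coeFn_parity f)] with t h1 h2
  simp only [Function.comp_apply] at h2
  rw [h1, h2, neg_neg]

theorem inner_parity_left (f g : L2 d) : ⟪parity d f, g⟫_ℂ = ⟪f, parity d g⟫_ℂ := by
  rw [← (parity d).inner_map_map f, parity_parity]

theorem parity_tfShift_parity (z : Phase d) (f : L2 d) :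
    parity d (tfShift z (parity d f)) = tfShift (-z) f := by
  have hneg := (Measure.measurePreserving_neg (volume : Measure (Rn d))).quasiMeasurePreserving
  apply Lp.ext
  filter_upwards [coeFn_parity (tfShift z (parity d f)), coeFn_tfShift (-z) f,
    hneg.ae_eq_comp (coeFn_tfShift z (parity d f)),
    hneg.ae_eq_comp ((measurePreserving_sub_right volume z.fst).quasiMeasurePreserving.ae_eq_comp
      (coeFn_parity f))] with t h1 h2 h3 h4
  simp only [Function.comp_apply] at h3 h4
  rw [h1, h2, h3, h4]
  simp [character, add_comm]

theorem opCheck_opCheck (A : Op d) : opCheck (opCheck A) = A := by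
  ext1 f
  simp [opCheck, parity_parity]

theorem inner_opShift (z : Phase d) (A : Op d) (ψ φ : L2 d) :
    ⟪ψ, opShift z A φ⟫_ℂ = ⟪ContinuousLinearMap.adjoint (tfShift z) ψ,
      A (ContinuousLinearMap.adjoint (tfShift z) φ)⟫_ℂ := by
  rw [ContinuousLinearMap.adjoint_inner_left]
  rfl

theorem isPositive_opShift (z : Phase d) {A : Op d} (hA : A.IsPositive) :
    (opShift z A).IsPositive := hA.conj_adjoint (tfShift z)

/-- Up to a phase, `π(z)*` is `π(-z)`. -/
theorem adjoint_tfShift_eq (z : Phase d) (ψ : L2 d) :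
    ∃ c : ℂ, ‖c‖ = 1 ∧ tfShift (-z) ψ = c • ContinuousLinearMap.adjoint (tfShift z) ψ := by
  refine ⟨_, norm_character (-z).snd (-z.fst), ?_⟩
  rw [← adjoint_tfShift_tfShift z (tfShift (-z) ψ), tfShift_tfShift, add_neg_cancel, tfShift_zero,
    map_smul]

theorem opShift_opCheck_rankOne (z : Phase d) (ψ : L2 d) :
    opShift z (opCheck (InnerProductSpace.rankOne ℂ ψ ψ))
      = InnerProductSpace.rankOne ℂ (tfShift z (parity d ψ)) (tfShift z (parity d ψ)) := by
  ext1 φ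
  have h : opShift z (opCheck (InnerProductSpace.rankOne ℂ ψ ψ)) φ
    = tfShift z (parity d (InnerProductSpace.rankOne ℂ ψ ψ
        (parity d (ContinuousLinearMap.adjoint (tfShift z) φ)))) := rfl
  rw [h, InnerProductSpace.rankOne_apply, InnerProductSpace.rankOne_apply, map_smul, map_smul,
    ← inner_parity_left, ContinuousLinearMap.adjoint_inner_right]

/-- `Q_S(ψ)(z) = ⟨α_z(S) ψ, ψ⟩`. -/
theorem cohen_eq_inner (S : Op d) (ψ : L2 d) (z : Phase d) :
    cohen S ψ z = ⟪ψ, opShift z S ψ⟫_ℂ := by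
  rw [cohen, opConv, opShift_opCheck_rankOne, trace_comp_rankOne, inner_opShift]
  change ⟪_, parity d (S (parity d _))⟫_ℂ = _
  rw [← inner_parity_left, parity_tfShift_parity]
  obtain ⟨c, hc, h⟩ := adjoint_tfShift_eq z ψ
  rw [h, map_smul, inner_smul_left, inner_smul_right, ← mul_assoc,
    ← Complex.normSq_eq_conj_mul_self, Complex.normSq_eq_norm_sq, hc]
  simp

theorem opTilde_eq_trace (S : Op d) (z : Phase d) : opTilde S z = trace (S ∘L opShift z S) := by
  rw [opTilde, opConv, opCheck_opCheck]

/-- The real-valued function `Q_S(ψ)(z) = ⟨α_z(S) ψ, ψ⟩`, for `S` positive. -/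
noncomputable def cohenReal (S : Op d) (ψ : L2 d) (z : Phase d) : ℝ := (⟪ψ, opShift z S ψ⟫_ℂ).re

theorem continuous_cohenReal (S : Op d) (ψ : L2 d) : Continuous (cohenReal S ψ) :=
  Complex.continuous_re.comp (continuous_const.inner (continuous_opShift_apply S ψ))

instance separableSpace_L2 : TopologicalSpace.SeparableSpace (L2 d) := by
  have : Fact ((2 : ℝ≥0∞) ≠ ∞) := ⟨by norm_num⟩
  infer_instance

instance countable_onb : Countable (exists_hilbertBasis ℂ (L2 d)).choose :=
  countable_of_orthonormal (onb (L2 d)).orthonormal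

section Positive

variable {S : Op d}

theorem cohenReal_nonneg (hS : S.IsPositive) (ψ : L2 d) (z : Phase d) : 0 ≤ cohenReal S ψ z :=
  re_inner_nonneg (isPositive_opShift z hS) ψ

theorem inner_opShift_eq_cohenReal (hS : S.IsPositive) (ψ : L2 d) (z : Phase d) :
    ⟪ψ, opShift z S ψ⟫_ℂ = (cohenReal S ψ z : ℂ) :=
  inner_eq_ofReal_of_isPositive (isPositive_opShift z hS) ψ

theorem ofReal_cohenReal (hS : S.IsPositive) (ψ : L2 d) (z : Phase d) :
    ENNReal.ofReal (cohenReal S ψ z) = ∑' k, ‖⟪tfShift z (sqrtVec S k), ψ⟫_ℂ‖ₑ ^ 2 := by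
  rw [cohenReal, inner_opShift, ofReal_re_inner_eq_tsum hS]
  simp_rw [ContinuousLinearMap.adjoint_inner_right]

theorem cohenReal_tfShift (hS : S.IsPositive) (ψ : L2 d) (z w : Phase d) :
    ENNReal.ofReal (cohenReal S (tfShift z ψ) w) = ENNReal.ofReal (cohenReal S ψ (w - z)) := by
  rw [ofReal_cohenReal hS, ofReal_cohenReal hS]
  refine tsum_congr fun k => ?_
  rw [← ofReal_norm, norm_inner_tfShift_tfShift, ofReal_norm]

theorem measurable_enorm_inner_tfShift (r ψ : L2 d) :
    Measurable fun z : Phase d => ‖⟪tfShift z r, ψ⟫_ℂ‖ₑ ^ 2 :=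
  (((continuous_tfShift r).inner continuous_const).enorm.measurable).pow_const 2

/-- `∫ Q_S(ψ) = tr(S) ‖ψ‖²`, by Moyal's identity applied to each term of `S = ∑ₖ rₖ ⊗ rₖ`. -/
theorem lintegral_cohenReal (hS : S.IsPositive) (htr : trace S = 1) (ψ : L2 d) :
    ∫⁻ z, ENNReal.ofReal (cohenReal S ψ z) = ‖ψ‖ₑ ^ 2 := by
  simp_rw [ofReal_cohenReal hS]
  rw [lintegral_tsum fun k => (measurable_enorm_inner_tfShift _ _).aemeasurable]
  simp_rw [lintegral_enorm_inner_tfShift_sq]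
  rw [ENNReal.tsum_mul_right, tsum_enorm_sqrtVec_sq hS htr, one_mul]

theorem enorm_tfShift (z : Phase d) (ψ : L2 d) : ‖tfShift z ψ‖ₑ = ‖ψ‖ₑ := by
  rw [← ofReal_norm, norm_tfShift_apply, ofReal_norm]

/-- By Bessel's inequality, `∑ⱼ Q_S(hⱼ)(z) ≤ tr(α_z(S)) = 1` for every orthonormal system `h`. -/
theorem tsum_cohenReal_le (hS : S.IsPositive) (htr : trace S = 1) {ι : Type*} {h : ι → L2 d}
    (hh : Orthonormal ℂ h) (z : Phase d) :
    ∑' j, ENNReal.ofReal (cohenReal S (h j) z) ≤ 1 := by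
  simp_rw [ofReal_cohenReal hS]
  rw [ENNReal.tsum_comm, ← tsum_enorm_sqrtVec_sq hS htr]
  refine ENNReal.tsum_le_tsum fun k => ?_
  rw [← enorm_tfShift z]
  refine le_trans (le_of_eq (tsum_congr fun j => ?_)) (tsum_enorm_inner_sq_le hh _)
  rw [← inner_conj_symm, RCLike.enorm_conj]

/-- `S̃(z) = tr(S α_z(S)) = ∑ₖ Q_S(rₖ)(z)`. -/
theorem ofReal_re_opTilde (hS : S.IsPositive) (htr : trace S = 1) (z : Phase d) :
    ENNReal.ofReal (opTilde S z).re = ∑' k, ENNReal.ofReal (cohenReal S (sqrtVec S k) z) := by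
  rw [opTilde_eq_trace, ofReal_re_trace_comp hS htr (isPositive_opShift z hS)]
  rfl

theorem re_opTilde_nonneg (hS : S.IsPositive) (htr : trace S = 1) (z : Phase d) :
    0 ≤ (opTilde S z).re := by
  rw [opTilde_eq_trace]
  exact re_trace_comp_nonneg hS htr (isPositive_opShift z hS)

theorem measurable_ofReal_re_opTilde (hS : S.IsPositive) (htr : trace S = 1) :
    Measurable fun z => ENNReal.ofReal (opTilde S z).re := by
  simp_rw [ofReal_re_opTilde hS htr]
  exact Measurable.tsum fun k => (continuous_cohenReal S _).measurable.ennreal_ofReal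

/-- `S̃` is a probability density. -/
theorem lintegral_re_opTilde (hS : S.IsPositive) (htr : trace S = 1) :
    ∫⁻ z, ENNReal.ofReal (opTilde S z).re = 1 := by
  simp_rw [ofReal_re_opTilde hS htr]
  rw [lintegral_tsum fun k => (continuous_cohenReal S _).measurable.ennreal_ofReal.aemeasurable]
  simp_rw [lintegral_cohenReal hS htr]
  exact tsum_enorm_sqrtVec_sq hS htr

end Positive

/-! ### The perimeter and translations -/

section Perimeter

variable {V : Type*} [NormedAddCommGroup V] [InnerProductSpace ℝ V] [FiniteDimensional ℝ V]
  [MeasurableSpace V] [BorelSpace V]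

theorem divergence_smul_const {V : Type*} [NormedAddCommGroup V] [InnerProductSpace ℝ V]
    [FiniteDimensional ℝ V] {φ : V → ℝ} (hφ : Differentiable ℝ φ) (u x : V) :
    divergence (fun y => φ y • u) x = fderiv ℝ φ x u := by
  rw [divergence, fderiv_smul_const (hφ x)]
  exact LinearMap.trace_smulRight (fderiv ℝ φ x : V →ₗ[ℝ] ℝ) u

/-- The vector field `φ v / |v|` is admissible in the definition of the perimeter. -/
theorem setIntegral_fderiv_le {Ω : Set V} (hΩ : IsCompact Ω) (hfin : perimeter Ω < ∞) {φ : V → ℝ}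
    (hφ : ContDiff ℝ 1 φ) (hφc : HasCompactSupport φ) (hφ1 : ∀ x, |φ x| ≤ 1) (v : V) :
    ∫ x in Ω, fderiv ℝ φ x v ≤ ‖v‖ * (perimeter Ω).toReal := by
  rcases eq_or_ne v 0 with rfl | hv
  · simp
  have hv' : 0 < ‖v‖ := norm_pos_iff.2 hv
  set u := ‖v‖⁻¹ • v with hu
  have hu1 : ‖u‖ = 1 := by rw [hu, norm_smul, norm_inv, norm_norm, inv_mul_cancel₀ hv'.ne']
  have hle : ENNReal.ofReal (∫ x, Ω.indicator (fun _ => (1 : ℝ)) x *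
      divergence (fun y => φ y • u) x) ≤ perimeter Ω := by
    refine le_iSup_of_le (fun y => φ y • u) (le_iSup_of_le (hφ.smul contDiff_const)
      (le_iSup_of_le hφc.smul_right (le_iSup_of_le (fun x => ?_) le_rfl)))
    rw [norm_smul, hu1, mul_one]
    exact hφ1 x
  rw [ENNReal.ofReal_le_iff_le_toReal hfin.ne] at hle
  have heq : ∫ x, Ω.indicator (fun _ => (1 : ℝ)) x * divergence (fun y => φ y • u) x
      = ‖v‖⁻¹ * ∫ x in Ω, fderiv ℝ φ x v := by
    rw [← integral_const_mul, ← integral_indicator hΩ.measurableSet]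
    refine integral_congr_ae (Eventually.of_forall fun x => ?_)
    by_cases hx : x ∈ Ω
    · beta_reduce
      rw [Set.indicator_of_mem hx, Set.indicator_of_mem hx,
        divergence_smul_const (hφ.differentiable one_ne_zero), hu, map_smul, smul_eq_mul, one_mul]
    · simp [hx]
  rw [heq, inv_mul_le_iff₀ hv'] at hle
  exact hle

/-- Translating a test function by `w` changes its integral over `Ω` by at most `|w| |∂Ω|`: along
the segment from `0` to `w`, the derivative of the integral is the integral over `Ω` of a
divergence. -/
theorem setIntegral_add_sub_le {Ω : Set V} (hΩ : IsCompact Ω) (hfin : perimeter Ω < ∞) {φ : V → ℝ}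
    (hφ : ContDiff ℝ 1 φ) (hφc : HasCompactSupport φ) (hφ1 : ∀ x, |φ x| ≤ 1) (w : V) :
    (∫ x in Ω, φ (x + w)) - ∫ x in Ω, φ x ≤ ‖w‖ * (perimeter Ω).toReal := by
  set K : ℝ → ℝ := fun s => ∫ x in Ω, φ (x + s • w) with hK
  have hdc : Continuous fun x => fderiv ℝ φ x w :=
    (hφ.continuous_fderiv one_ne_zero).clm_apply continuous_const
  obtain ⟨C, hC⟩ : ∃ C, ∀ x, ‖fderiv ℝ φ x w‖ ≤ C := by
    refine HasCompactSupport.exists_bound_of_continuous ?_ hdc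
    exact (hφc.fderiv ℝ).comp_left (g := fun L : V →L[ℝ] ℝ => L w) rfl
  -- the constant `C` dominates the derivative in `s`, which justifies differentiating under `∫`
  have hfm : IsFiniteMeasure (volume.restrict Ω) := ⟨by simpa using hΩ.measure_lt_top⟩
  have hder : ∀ s, HasDerivAt K (∫ x in Ω, fderiv ℝ φ (x + s • w) w) s := by
    intro s
    refine (hasDerivAt_integral_of_dominated_loc_of_deriv_le (bound := fun _ => C)
      (F := fun t x => φ (x + t • w)) (F' := fun t x => fderiv ℝ φ (x + t • w) w)
      (Filter.univ_mem) ?_ ?_ ?_ ?_ (integrable_const C) ?_).2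
    · refine Eventually.of_forall fun t => Continuous.aestronglyMeasurable ?_
      have := hφ.continuous
      fun_prop
    · have hc : Continuous fun x => φ (x + s • w) := by
        have := hφ.continuous
        fun_prop
      exact hc.continuousOn.integrableOn_compact hΩ
    · exact (hdc.comp (continuous_id.add continuous_const)).aestronglyMeasurable
    · exact Eventually.of_forall fun x t _ => hC _
    · refine Eventually.of_forall fun x t _ => ?_
      have h1 : HasDerivAt (fun t : ℝ => x + t • w) w t := by
        simpa using ((hasDerivAt_id t).smul_const w).const_add x
      exact ((hφ.differentiable one_ne_zero) _).hasFDerivAt.comp_hasDerivAt t h1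
  have hle : ∀ s, deriv K s ≤ ‖w‖ * (perimeter Ω).toReal := by
    intro s
    rw [(hder s).deriv]
    have h := setIntegral_fderiv_le hΩ hfin (φ := fun x => φ (x + s • w))
      (hφ.comp (contDiff_id.add contDiff_const)) (hφc.comp_homeomorph (Homeomorph.addRight (s • w)))
      (fun x => hφ1 _) w
    simpa only [fderiv_comp_add_right] using h
  have := image_sub_le_mul_sub_of_deriv_le (fun s => (hder s).differentiableAt) hle zero_le_one
  simpa [hK] using this

/-- A set of finite measure can be tested against smooth functions: approximate it from inside by a
compact set `K`, enclose `K` in a slightly larger bounded open set, and take a smooth bump. -/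
theorem measureReal_le_of_forall_integral_le {E : Set V} (hE : MeasurableSet E)
    (hEfin : volume E ≠ ∞) {E' : Set V} (hE' : MeasurableSet E') (hd : Disjoint E E') {c : ℝ}
    (h : ∀ φ : V → ℝ, ContDiff ℝ 1 φ → HasCompactSupport φ → (∀ x, |φ x| ≤ 1) →
      (∫ x in E, φ x) - ∫ x in E', φ x ≤ c) :
    volume.real E ≤ c := by
  refine le_of_forall_pos_le_add fun η hη => ?_
  obtain ⟨K, hKE, hKc, hK⟩ := hE.exists_isCompact_sdiff_lt hEfin
    (ENNReal.ofReal_pos.2 (half_pos hη)).ne'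
  obtain ⟨U, hKU, hUo, hU⟩ := K.exists_isOpen_lt_of_lt _
    (ENNReal.lt_add_right (hKc.measure_ne_top (μ := volume))
      (ENNReal.ofReal_pos.2 (half_pos hη)).ne')
  obtain ⟨R, hR⟩ := hKc.isBounded.subset_ball (0 : V)
  set W := U ∩ Metric.ball 0 R with hW
  have hWo : IsOpen W := hUo.inter Metric.isOpen_ball
  obtain ⟨f, hf0, hf1, hf⟩ := exists_contMDiffMap_zero_one_of_isClosed
    (modelWithCornersSelf ℝ V) (n := 1) hWo.isClosed_compl hKc.isClosed
    (Set.disjoint_left.2 fun x hx hxK => hx ⟨hKU hxK, hR hxK⟩)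
  have hfd : ContDiff ℝ 1 f := f.contMDiff.contDiff
  have hfs : Function.support f ⊆ W := fun x hx => by
    by_contra hxW
    exact hx (hf0 hxW)
  have hfc : HasCompactSupport f :=
    HasCompactSupport.intro (isCompact_closedBall (0 : V) R) fun x hx => hf0 fun hxW =>
      hx (Metric.ball_subset_closedBall hxW.2)
  have hfi : Integrable f := hfd.continuous.integrable_of_hasCompactSupport hfc
  have hfabs : ∀ x, |f x| ≤ 1 := fun x => abs_le.2 ⟨by linarith [(hf x).1], (hf x).2⟩
  have h1 : volume.real K ≤ ∫ x in E, f x := by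
    calc volume.real K = ∫ x in K, f x := by
          rw [setIntegral_congr_fun hKc.measurableSet (g := fun _ => (1 : ℝ)) fun x hx => hf1 hx]
          simp
      _ ≤ ∫ x in E, f x := setIntegral_mono_set hfi.integrableOn
          (Eventually.of_forall fun x => (hf x).1) hKE.eventuallyLE
  have h2 : ∫ x in E', f x ≤ volume.real (U \ K) := by
    have hUf : volume (U \ K) ≠ ∞ := ne_top_of_le_ne_top hU.ne_top (measure_mono Set.sdiff_subset)
    have hUm : MeasurableSet (U \ K) := hUo.measurableSet.diff hKc.measurableSet
    rw [← integral_indicator hE', ← integral_indicator_one hUm]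
    refine integral_mono (hfi.indicator hE') ?_ fun x => ?_
    · exact (integrable_indicator_iff hUm).2 (integrableOn_const hUf)
    · by_cases hx : x ∈ E' ∩ Function.support f
      · have hxU : x ∈ U \ K := ⟨(hfs hx.2).1, fun hxK => Set.disjoint_left.1 hd (hKE hxK) hx.1⟩
        rw [Set.indicator_of_mem hx.1, Set.indicator_of_mem hxU]
        exact (hf x).2
      · have : E'.indicator f x = 0 := by
          by_cases hxE : x ∈ E'
          · rw [Set.indicator_of_mem hxE]
            by_contra hne
            exact hx ⟨hxE, hne⟩
          · exact Set.indicator_of_notMem hxE _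
        change E'.indicator f x ≤ _
        rw [this]
        exact Set.indicator_nonneg (fun _ _ => zero_le_one) _
  have h3 := h f hfd hfc hfabs
  have h4 : volume.real (U \ K) ≤ η / 2 := by
    refine ENNReal.toReal_le_of_le_ofReal (half_pos hη).le ?_
    rw [measure_sdiff hKU hKc.measurableSet.nullMeasurableSet hKc.measure_ne_top]
    exact tsub_le_iff_left.2 hU.le
  have h5 : volume.real E ≤ volume.real K + η / 2 := by
    have : volume.real (E \ K) ≤ η / 2 :=
      ENNReal.toReal_le_of_le_ofReal (half_pos hη).le hK.le
    have h6 : volume.real E ≤ volume.real (E \ K) + volume.real K := by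
      refine le_trans (measureReal_mono ?_ ?_) (measureReal_union_le _ _)
      · rw [Set.sdiff_union_self]; exact Set.subset_union_left
      · exact measure_union_ne_top (ne_top_of_le_ne_top hEfin (measure_mono Set.sdiff_subset))
          hKc.measure_ne_top
    linarith
  linarith

/-- The part of `Ω` that the translation by `w` moves out of `Ω` has measure at most `|w| |∂Ω|`. -/
theorem volume_diff_preimage_add_le {Ω : Set V} (hΩ : IsCompact Ω) (hfin : perimeter Ω < ∞)
    (w : V) : volume (Ω \ (fun z => z + w) ⁻¹' Ω) ≤ ‖w‖ₑ * perimeter Ω := by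
  have hpre : IsCompact ((fun z => z + w) ⁻¹' Ω) :=
    (Homeomorph.addRight w).isCompact_preimage.2 hΩ
  have hm1 := hΩ.measurableSet
  have hm2 := hpre.measurableSet
  set Ω' := (fun z => z + w) ⁻¹' Ω with hΩ'
  have hfinE : volume (Ω \ Ω') ≠ ∞ :=
    ne_top_of_le_ne_top hΩ.measure_ne_top (measure_mono Set.sdiff_subset)
  have key : volume.real (Ω \ Ω') ≤ ‖w‖ * (perimeter Ω).toReal := by
    refine measureReal_le_of_forall_integral_le (hm1.diff hm2) hfinE (hm2.diff hm1)
      (Set.disjoint_left.2 fun x hx hx' => hx.2 hx'.1) fun φ hφ hφc hφ1 => ?_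
    have hφi : Integrable φ := hφ.continuous.integrable_of_hasCompactSupport hφc
    have h := setIntegral_add_sub_le hΩ hfin (φ := fun x => φ (x - w))
      (hφ.comp (contDiff_id.sub contDiff_const)) (hφc.comp_homeomorph (Homeomorph.subRight w))
      (fun x => hφ1 _) w
    have h2 := (measurePreserving_add_right (volume : Measure V) w).setIntegral_preimage_emb
      (measurableEmbedding_addRight w) (fun x => φ (x - w)) Ω
    simp only [add_sub_cancel_right] at h h2
    rw [← h2, ← hΩ'] at h
    have h3 := integral_inter_add_sdiff (μ := volume) hm2 (hφi.integrableOn (s := Ω))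
    have h4 := integral_inter_add_sdiff (μ := volume) hm1 (hφi.integrableOn (s := Ω'))
    rw [Set.inter_comm] at h4
    linarith
  rw [← ENNReal.ofReal_toReal hfinE, ← ENNReal.ofReal_toReal hfin.ne, ← ofReal_norm,
    ← ENNReal.ofReal_mul (norm_nonneg _)]
  exact ENNReal.ofReal_le_ofReal key

end Perimeter

/-! ### The eigenvalues of the localization operator -/

section Localization

variable {S : Op d} {Ω : Set (Phase d)}

theorem integrable_chi (hΩ : IsCompact Ω) : Integrable (chi Ω) :=
  (integrable_indicator_iff hΩ.measurableSet).2 (integrableOn_const hΩ.measure_ne_top)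

theorem inner_locOp (hS : S.IsPositive) (hΩ : IsCompact Ω) (ψ : L2 d) :
    ⟪ψ, locOp Ω S ψ⟫_ℂ = ((∫ z in Ω, cohenReal S ψ z : ℝ) : ℂ) := by
  rw [locOp, funOpConv_spec (integrable_chi hΩ) S ψ ψ, ← integral_complex_ofReal,
    ← integral_indicator hΩ.measurableSet]
  refine integral_congr_ae (Eventually.of_forall fun z => ?_)
  by_cases hz : z ∈ Ω <;> simp [chi, hz, inner_opShift_eq_cohenReal hS]

theorem ofReal_setIntegral_cohenReal (hS : S.IsPositive) (hΩ : IsCompact Ω) (ψ : L2 d) :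
    ENNReal.ofReal (∫ z in Ω, cohenReal S ψ z)
      = ∫⁻ z in Ω, ENNReal.ofReal (cohenReal S ψ z) :=
  ofReal_integral_eq_lintegral_ofReal
    ((continuous_cohenReal S ψ).continuousOn.integrableOn_compact hΩ)
    (Eventually.of_forall fun z => cohenReal_nonneg hS ψ z)

variable {lam : ℕ → ℝ} {h : ℕ → L2 d}

/-- Both sides are `⟨(χ_Ω ⋆ S) ψ, ψ⟩`: by the spectral representation and by the definition of
`χ_Ω ⋆ S` as a weak integral. -/
theorem hasSum_setIntegral_cohenReal (hS : S.IsPositive) (hΩ : IsCompact Ω)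
    (hspec : IsSpectralRep (locOp Ω S) lam h) (ψ : L2 d) :
    HasSum (fun k => lam k * ‖⟪h k, ψ⟫_ℂ‖ ^ 2) (∫ z in Ω, cohenReal S ψ z) := by
  have hsum := (innerSL ℂ ψ).hasSum (hspec.hasSum ψ)
  rw [innerSL_apply_apply, inner_locOp hS hΩ] at hsum
  refine Complex.hasSum_ofReal.1 ?_
  convert! hsum using 2 with k
  simp only [innerSL_apply_apply, InnerProductSpace.rankOne_apply, inner_smul_right]
  rw [← inner_conj_symm ψ (h k), Complex.mul_conj, Complex.normSq_eq_norm_sq]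
  push_cast
  rfl

theorem eigenvalue_eq (hS : S.IsPositive) (hΩ : IsCompact Ω)
    (hspec : IsSpectralRep (locOp Ω S) lam h) (j : ℕ) :
    lam j = ∫ z in Ω, cohenReal S (h j) z := by
  refine HasSum.unique ?_ (hasSum_setIntegral_cohenReal hS hΩ hspec (h j))
  convert hasSum_single j fun k hk => ?_ using 1
  · simp [hspec.orthonormal.1 j]
  · rw [hspec.orthonormal.2 hk]
    simp

theorem eigenvalue_nonneg (hS : S.IsPositive) (hΩ : IsCompact Ω)
    (hspec : IsSpectralRep (locOp Ω S) lam h) (j : ℕ) : 0 ≤ lam j := by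
  rw [eigenvalue_eq hS hΩ hspec]
  exact integral_nonneg fun z => cohenReal_nonneg hS _ z

theorem ofReal_eigenvalue (hS : S.IsPositive) (hΩ : IsCompact Ω)
    (hspec : IsSpectralRep (locOp Ω S) lam h) (j : ℕ) :
    ENNReal.ofReal (lam j) = ∫⁻ z in Ω, ENNReal.ofReal (cohenReal S (h j) z) := by
  rw [eigenvalue_eq hS hΩ hspec, ofReal_setIntegral_cohenReal hS hΩ]

theorem tsum_ofReal_eigenvalue_mul (hS : S.IsPositive) (hΩ : IsCompact Ω)
    (hspec : IsSpectralRep (locOp Ω S) lam h) (ψ : L2 d) :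
    ∑' k, ENNReal.ofReal (lam k) * ‖⟪h k, ψ⟫_ℂ‖ₑ ^ 2
      = ∫⁻ z in Ω, ENNReal.ofReal (cohenReal S ψ z) := by
  have hs := hasSum_setIntegral_cohenReal hS hΩ hspec ψ
  rw [← ofReal_setIntegral_cohenReal hS hΩ, ← hs.tsum_eq, ENNReal.ofReal_tsum_of_nonneg
    (fun k => mul_nonneg (eigenvalue_nonneg hS hΩ hspec k) (sq_nonneg _)) hs.summable]
  refine tsum_congr fun k => ?_
  rw [ENNReal.ofReal_mul (eigenvalue_nonneg hS hΩ hspec k), ofReal_norm_sq]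

theorem eigenvalue_le_one (hS : S.IsPositive) (htr : trace S = 1) (hΩ : IsCompact Ω)
    (hspec : IsSpectralRep (locOp Ω S) lam h) (j : ℕ) : lam j ≤ 1 := by
  rw [← ENNReal.ofReal_le_one, ofReal_eigenvalue hS hΩ hspec]
  refine (setLIntegral_le_lintegral _ _).trans ?_
  rw [lintegral_cohenReal hS htr, ← ofReal_norm, hspec.orthonormal.1 j]
  simp

/-- The trace of `χ_Ω ⋆ S` is `|Ω|`; the inequality, which needs only Bessel's inequality for the
eigenfunctions, is enough here. -/
theorem tsum_ofReal_eigenvalue_le (hS : S.IsPositive) (htr : trace S = 1) (hΩ : IsCompact Ω)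
    (hspec : IsSpectralRep (locOp Ω S) lam h) :
    ∑' j, ENNReal.ofReal (lam j) ≤ volume Ω := by
  simp_rw [ofReal_eigenvalue hS hΩ hspec]
  rw [← lintegral_tsum fun k =>
    (continuous_cohenReal S _).measurable.ennreal_ofReal.aemeasurable, ← setLIntegral_one]
  exact lintegral_mono fun z => tsum_cohenReal_le hS htr hspec.orthonormal z

/-- `tr((χ_Ω ⋆ S)²) = ∫_Ω ∫_Ω S̃(z' - z) dz' dz`. -/
theorem tsum_ofReal_eigenvalue_sq (hS : S.IsPositive) (htr : trace S = 1) (hΩ : IsCompact Ω)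
    (hspec : IsSpectralRep (locOp Ω S) lam h) :
    ∑' j, ENNReal.ofReal (lam j) ^ 2
      = ∫⁻ z in Ω, ∫⁻ z' in Ω, ENNReal.ofReal (opTilde S (z' - z)).re := by
  have hmeas : ∀ ψ : L2 d, Measurable fun z => ENNReal.ofReal (cohenReal S ψ z) := fun ψ =>
    (continuous_cohenReal S ψ).measurable.ennreal_ofReal
  calc ∑' j, ENNReal.ofReal (lam j) ^ 2
      = ∑' j, ∫⁻ z in Ω, ENNReal.ofReal (lam j) * ENNReal.ofReal (cohenReal S (h j) z) := by
        refine tsum_congr fun j => ?_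
        rw [lintegral_const_mul _ (hmeas _), ← ofReal_eigenvalue hS hΩ hspec, sq]
    _ = ∫⁻ z in Ω, ∑' j, ENNReal.ofReal (lam j) * ENNReal.ofReal (cohenReal S (h j) z) :=
        (lintegral_tsum fun j => ((hmeas _).const_mul _).aemeasurable).symm
    _ = _ := by
        refine lintegral_congr fun z => ?_
        simp_rw [ofReal_cohenReal hS, ← ENNReal.tsum_mul_left]
        rw [ENNReal.tsum_comm]
        have hk : ∀ k, ∑' j, ENNReal.ofReal (lam j) * ‖⟪tfShift z (sqrtVec S k), h j⟫_ℂ‖ₑ ^ 2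
            = ∫⁻ z' in Ω, ENNReal.ofReal (cohenReal S (sqrtVec S k) (z' - z)) := by
          intro k
          simp_rw [← cohenReal_tfShift hS, ← tsum_ofReal_eigenvalue_mul hS hΩ hspec]
          refine tsum_congr fun j => ?_
          rw [← inner_conj_symm, RCLike.enorm_conj]
        simp_rw [hk]
        simp_rw [ofReal_re_opTilde hS htr]
        exact (lintegral_tsum fun k =>
          ((hmeas _).comp (measurable_id.sub_const z)).aemeasurable).symm

/-- `|Ω| - tr((χ_Ω ⋆ S)²)` is the average, weighted by `S̃`, of the measure of the part of `Ω`
that a translation moves out of `Ω`. -/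
theorem volume_eq_add_lintegral (hS : S.IsPositive) (htr : trace S = 1) (hΩ : IsCompact Ω)
    (hspec : IsSpectralRep (locOp Ω S) lam h) :
    volume Ω = ∑' j, ENNReal.ofReal (lam j) ^ 2
      + ∫⁻ w, ENNReal.ofReal (opTilde S w).re * volume (Ω \ (fun z => z + w) ⁻¹' Ω) := by
  have hm := measurable_ofReal_re_opTilde hS htr
  set g : Phase d → ℝ≥0∞ := fun w => ENNReal.ofReal (opTilde S w).re with hg
  have hΩm := hΩ.measurableSet
  have hmm : Measurable fun p : Phase d × Phase d => g (p.2 - p.1) :=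
    hm.comp (measurable_snd.sub measurable_fst)
  have hsplit : ∀ z : Phase d, 1 = (∫⁻ z' in Ω, g (z' - z)) + ∫⁻ z' in Ωᶜ, g (z' - z) := by
    intro z
    rw [lintegral_add_compl _ hΩm, lintegral_sub_right_eq_self g z, lintegral_re_opTilde hS htr]
  have hout : ∀ z : Phase d, ∫⁻ z' in Ωᶜ, g (z' - z)
      = ∫⁻ w, g w * Ωᶜ.indicator 1 (z + w) := by
    intro z
    rw [← lintegral_indicator hΩm.compl, ← lintegral_add_left_eq_self _ z]
    refine lintegral_congr fun w => ?_
    by_cases hw : z + w ∈ Ω <;> simp [hw]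
  rw [tsum_ofReal_eigenvalue_sq hS htr hΩ hspec]
  calc volume Ω = ∫⁻ z in Ω, 1 := (setLIntegral_one Ω).symm
    _ = ∫⁻ z in Ω, ((∫⁻ z' in Ω, g (z' - z)) + ∫⁻ z' in Ωᶜ, g (z' - z)) :=
        lintegral_congr fun z => hsplit z
    _ = (∫⁻ z in Ω, ∫⁻ z' in Ω, g (z' - z)) + ∫⁻ z in Ω, ∫⁻ z' in Ωᶜ, g (z' - z) :=
        lintegral_add_left hmm.lintegral_prod_right' _
    _ = _ := by
        congr 1
        simp_rw [hout]
        have hind : Measurable fun p : Phase d × Phase d =>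
            Ωᶜ.indicator (1 : Phase d → ℝ≥0∞) (p.1 + p.2) :=
          (measurable_one.indicator hΩm.compl).comp (measurable_fst.add measurable_snd)
        rw [lintegral_lintegral_swap]
        · refine lintegral_congr fun w => ?_
          have hindw : Measurable fun z : Phase d => Ωᶜ.indicator (1 : Phase d → ℝ≥0∞) (z + w) :=
            hind.comp measurable_prodMk_right
          rw [lintegral_const_mul _ hindw]
          congr 1
          have hpre : MeasurableSet ((fun z => z + w) ⁻¹' Ω) :=
            hΩm.preimage (measurable_add_const w)
          rw [← lintegral_indicator hΩm, ← lintegral_indicator_one (hΩm.diff hpre)]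
          refine lintegral_congr fun z => ?_
          by_cases hz : z ∈ Ω <;> by_cases hw : z + w ∈ Ω <;> simp [hz, hw]
        · exact ((hm.comp measurable_snd).mul hind).aemeasurable

theorem ofReal_mopNorm_sq (hS : MemMop S) :
    ENNReal.ofReal (mopNorm S ^ 2) = ∫⁻ w, ENNReal.ofReal (opTilde S w).re * ‖w‖ₑ := by
  have h0 : ∀ w : Phase d, 0 ≤ (opTilde S w).re * ‖w‖ := fun w =>
    mul_nonneg (re_opTilde_nonneg hS.isPositive hS.trace_eq_one w) (norm_nonneg _)
  rw [mopNorm, Real.sq_sqrt (integral_nonneg h0),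
    ofReal_integral_eq_lintegral_ofReal hS.integrable (Eventually.of_forall h0)]
  refine lintegral_congr fun w => ?_
  rw [ENNReal.ofReal_mul (re_opTilde_nonneg hS.isPositive hS.trace_eq_one w), ofReal_norm]

theorem volume_le_tsum_sq_add (hS : MemMop S) (hΩ : IsCompact Ω) (hfin : perimeter Ω < ∞)
    (hspec : IsSpectralRep (locOp Ω S) lam h) :
    volume Ω ≤ ∑' j, ENNReal.ofReal (lam j) ^ 2
      + ENNReal.ofReal (mopNorm S ^ 2) * perimeter Ω := by
  rw [volume_eq_add_lintegral hS.isPositive hS.trace_eq_one hΩ hspec, ofReal_mopNorm_sq hS,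
    ← lintegral_mul_const' _ _ hfin.ne]
  refine add_le_add_right (lintegral_mono fun w => ?_) _
  rw [mul_assoc]
  exact mul_le_mul_right (volume_diff_preimage_add_le hΩ hfin w) _

end Localization

/-- For a decreasing sequence in `[0, 1]` with sum at most `N`, the sum of the squares is at most
the sum of the first `N` terms: with `μ = λ_N`, the tail contributes at most `μ ∑_{k ≥ N} λ_k` to
the squares, while passing from `λ_k` to `λ_k²` for `k < N` loses at least
`μ ∑_{k < N} (1 - λ_k)`. -/
theorem tsum_sq_le_sum_range {lam : ℕ → ℝ} (hanti : Antitone lam) (h0 : ∀ k, 0 ≤ lam k)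
    (h1 : ∀ k, lam k ≤ 1) (hs : Summable lam) {N : ℕ} (hN : ∑' k, lam k ≤ N) :
    ∑' k, lam k ^ 2 ≤ ∑ k ∈ Finset.range N, lam k := by
  have hs2 : Summable fun k => lam k ^ 2 :=
    Summable.of_nonneg_of_le (fun k => sq_nonneg _) (fun k => by nlinarith [h0 k, h1 k]) hs
  rw [← hs2.sum_add_tsum_nat_add N]
  rw [← hs.sum_add_tsum_nat_add N] at hN
  have htail : ∑' k, lam (k + N) ^ 2 ≤ lam N * ∑' k, lam (k + N) := by
    rw [← tsum_mul_left]
    refine Summable.tsum_le_tsum (fun k => ?_) ((summable_nat_add_iff N).2 hs2)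
      (((summable_nat_add_iff N).2 hs).mul_left _)
    rw [sq]
    exact mul_le_mul_of_nonneg_right (hanti (Nat.le_add_left N k)) (h0 _)
  have hhead : ∑ k ∈ Finset.range N, lam N * (1 - lam k)
      ≤ ∑ k ∈ Finset.range N, (lam k - lam k ^ 2) := by
    refine Finset.sum_le_sum fun k hk => ?_
    have := hanti (Finset.mem_range.1 hk).le
    nlinarith [h1 k]
  rw [← Finset.mul_sum, Finset.sum_sub_distrib, Finset.sum_sub_distrib, Finset.sum_const,
    Finset.card_range, nsmul_eq_mul, mul_one] at hhead
  have := mul_le_mul_of_nonneg_left hN (h0 N)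
  linarith

section Accumulated

variable {S : Op d} {Ω : Set (Phase d)} {lam : ℕ → ℝ} {h : ℕ → L2 d}

/-- The measure of `Ω` not captured by the first `⌈|Ω|⌉` eigenvalues is at most `‖S‖² |∂Ω|`, because
it is at most `|Ω| - ∑ₖ λₖ²`. -/
theorem volume_real_sub_sum_le (hS : MemMop S) (hΩ : IsCompact Ω) (hfin : perimeter Ω < ∞)
    (hspec : IsSpectralRep (locOp Ω S) lam h) :
    volume.real Ω - ∑ k ∈ Finset.range ⌈volume.real Ω⌉₊, lam k
      ≤ mopNorm S ^ 2 * (perimeter Ω).toReal := by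
  have h0 := eigenvalue_nonneg hS.isPositive hΩ hspec
  have h1 := eigenvalue_le_one hS.isPositive hS.trace_eq_one hΩ hspec
  have htr := tsum_ofReal_eigenvalue_le hS.isPositive hS.trace_eq_one hΩ hspec
  have hs : Summable lam := by
    refine (ENNReal.summable_toReal (ne_top_of_le_ne_top hΩ.measure_ne_top htr)).congr fun k => ?_
    exact ENNReal.toReal_ofReal (h0 k)
  have hs2 : Summable fun k => lam k ^ 2 :=
    Summable.of_nonneg_of_le (fun k => sq_nonneg _) (fun k => by nlinarith [h0 k, h1 k]) hs
  have hle : ∑' k, lam k ≤ volume.real Ω := by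
    rw [← ENNReal.ofReal_tsum_of_nonneg h0 hs] at htr
    exact (ENNReal.ofReal_le_iff_le_toReal hΩ.measure_ne_top).1 htr
  have hsq := tsum_sq_le_sum_range hspec.antitone h0 h1 hs (hle.trans (Nat.le_ceil _))
  have hv := volume_le_tsum_sq_add hS hΩ hfin hspec
  simp_rw [← ENNReal.ofReal_pow (h0 _)] at hv
  rw [← ENNReal.ofReal_tsum_of_nonneg (fun k => sq_nonneg _) hs2,
    ← ENNReal.ofReal_toReal hfin.ne, ← ENNReal.ofReal_mul (sq_nonneg _),
    ← ENNReal.ofReal_add (tsum_nonneg fun k => sq_nonneg _) (by positivity)] at hv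
  have hv' := ENNReal.toReal_le_of_le_ofReal (add_nonneg (tsum_nonneg fun k => sq_nonneg _)
    (by positivity)) hv
  rw [← measureReal_def] at hv'
  linarith

theorem integrable_cohenReal (hS : S.IsPositive) (htr : trace S = 1) (ψ : L2 d) :
    Integrable (cohenReal S ψ) := by
  refine ⟨(continuous_cohenReal S ψ).aestronglyMeasurable, ?_⟩
  rw [hasFiniteIntegral_iff_ofReal (Eventually.of_forall fun z => cohenReal_nonneg hS ψ z),
    lintegral_cohenReal hS htr]
  simp

theorem integral_cohenReal (hS : S.IsPositive) (htr : trace S = 1) (ψ : L2 d) :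
    ∫ z, cohenReal S ψ z = ‖ψ‖ ^ 2 := by
  rw [integral_eq_lintegral_of_nonneg_ae (Eventually.of_forall fun z => cohenReal_nonneg hS ψ z)
    (continuous_cohenReal S ψ).aestronglyMeasurable, lintegral_cohenReal hS htr, ← ofReal_norm_sq,
    ENNReal.toReal_ofReal (sq_nonneg _)]

theorem sum_cohenReal_le_one (hS : S.IsPositive) (htr : trace S = 1) (hh : Orthonormal ℂ h)
    (N : ℕ) (z : Phase d) : ∑ k ∈ Finset.range N, cohenReal S (h k) z ≤ 1 := by
  rw [← ENNReal.ofReal_le_one, ENNReal.ofReal_sum_of_nonneg fun k _ => cohenReal_nonneg hS _ z]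
  exact (ENNReal.sum_le_tsum _).trans (tsum_cohenReal_le hS htr hh z)

end Accumulated

end QHA

/-! ### The `L¹` estimate -/

theorem mainTheorem5 (d : ℕ) (ε : ℝ) (hε : 0 < ε)
    (S : Op d) (hS : MemMop S)
    (Ω : Set (Phase d)) (hΩ : IsCompact Ω)
    (hfin : perimeter Ω < ⊤) (hper : ENNReal.ofReal ε ≤ perimeter Ω)
    (lam : ℕ → ℝ) (h : ℕ → L2 d) (hspec : IsSpectralRep (locOp Ω S) lam h) :
    Integrable (fun z => accumulatedCohen Ω S h z - chi Ω z) ∧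
      ∫ z, ‖accumulatedCohen Ω S h z - chi Ω z‖ ≤
        (1 / ε + 2 * mopNorm S ^ 2) * (perimeter Ω).toReal := by
  have hp := hS.isPositive
  have htr := hS.trace_eq_one
  set N := ⌈volume.real Ω⌉₊ with hN
  set G : Phase d → ℝ := fun z => ∑ k ∈ Finset.range N, cohenReal S (h k) z with hG
  have hGi : Integrable G := integrable_finsetSum _ fun k _ => integrable_cohenReal hp htr (h k)
  have hG0 : ∀ z, 0 ≤ G z := fun z => Finset.sum_nonneg fun k _ => cohenReal_nonneg hp _ z
  have hG1 : ∀ z, G z ≤ 1 := sum_cohenReal_le_one hp htr hspec.orthonormal N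
  have hacc : ∀ z, accumulatedCohen Ω S h z = (G z : ℂ) := by
    intro z
    rw [accumulatedCohen, hG, Complex.ofReal_sum]
    exact Finset.sum_congr rfl fun k _ => by rw [cohen_eq_inner, inner_opShift_eq_cohenReal hp]
  simp_rw [hacc]
  refine ⟨hGi.ofReal.sub (integrable_chi hΩ), ?_⟩
  have hone : Integrable (Ω.indicator fun _ => (1 : ℝ)) :=
    (integrable_indicator_iff hΩ.measurableSet).2 (integrableOn_const hΩ.measure_ne_top)
  have hGΩ : Integrable (Ω.indicator G) := hGi.indicator hΩ.measurableSet
  -- since `0 ≤ ρ ≤ 1`, the modulus `|ρ - χ_Ω|` is `ρ + χ_Ω - 2 χ_Ω ρ`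
  have hnorm : ∀ z, ‖(G z : ℂ) - chi Ω z‖
      = G z + Ω.indicator (fun _ => (1 : ℝ)) z - 2 * Ω.indicator G z := by
    intro z
    by_cases hz : z ∈ Ω
    · have : (G z : ℂ) - chi Ω z = ((G z - 1 : ℝ) : ℂ) := by simp [chi, hz]
      rw [this, Complex.norm_real, Real.norm_eq_abs, abs_of_nonpos (by linarith [hG1 z]),
        Set.indicator_of_mem hz, Set.indicator_of_mem hz]
      ring
    · simp [chi, hz, abs_of_nonneg (hG0 z)]
  have hGint : ∫ z, G z = N := by
    rw [integral_finsetSum _ fun k _ => integrable_cohenReal hp htr (h k)]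
    simp [integral_cohenReal hp htr, hspec.orthonormal.1]
  have hGΩint : ∫ z, Ω.indicator G z = ∑ k ∈ Finset.range N, lam k := by
    rw [integral_indicator hΩ.measurableSet,
      integral_finsetSum _ fun k _ => (integrable_cohenReal hp htr (h k)).integrableOn]
    exact Finset.sum_congr rfl fun k _ => (eigenvalue_eq hp hΩ hspec k).symm
  have honeint : ∫ z, Ω.indicator (fun _ => (1 : ℝ)) z = volume.real Ω :=
    integral_indicator_one hΩ.measurableSet
  have hint : ∫ z, ‖(G z : ℂ) - chi Ω z‖
      = N + volume.real Ω - 2 * ∑ k ∈ Finset.range N, lam k := by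
    simp_rw [hnorm]
    rw [integral_sub (by exact hGi.add hone) (hGΩ.const_mul 2), integral_add hGi hone,
      integral_const_mul, hGint, hGΩint, honeint]
  rw [hint]
  have hNle : (N : ℝ) < volume.real Ω + 1 := Nat.ceil_lt_add_one measureReal_nonneg
  -- `∫ |ρ - χ_Ω| = (N - |Ω|) + 2 (|Ω| - ∑_{k < N} λ_k)`, and `N - |Ω| < 1 ≤ |∂Ω| / ε`
  have hR := volume_real_sub_sum_le hS hΩ hfin hspec
  have hεP : 1 ≤ 1 / ε * (perimeter Ω).toReal := by
    rw [one_div, ← div_eq_inv_mul, one_le_div hε]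
    exact (ENNReal.ofReal_le_iff_le_toReal hfin.ne).1 hper
  linarith
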